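/- **Setting.** Let $L$ be a positive-definite even lattice with form $\langle\cdot,\cdot\rangle$, let $\sigma$ be an automorphism of $L$ (preserving the form) of odd order $p$, let $s=2p$, let $\xi\in\mathbb C$ be a primitive $s$-th root of unity and $\zeta=\xi^2$. Let $\varepsilon_0:L\times L\to\mathbb Z/s\mathbb Z$ be a $\sigma$-invariant normalized $2$-cocycle with $\varepsilon_0(\alpha,\beta)-\varepsilon_0(\beta,\alpha)=\frac s2\langle\alpha,\beta\rangle+s\mathbb Z$. Let $\mathfrak h=\mathbb C\otimes_{\mathbb Z}L$, $\mathfrak h_{(n)}=\{h\in\mathfrak h:\sigma h=\zeta^n h\}$, and write $h_{(n)}$ for the projection of $h$ to $\mathfrak h_{(n)}$. Let $V_L=M(1)\otimes\mathbb C\{L\}$, where $M(1)$ is the symmetric algebra on the symbols $h(-n)$ ($h\in\mathfrak h$, linear in $h$, $n\in\mathbb Z_{>0}$), i.e. the Fock module of the Heisenberg algebra $\hat{\mathfrak h}$, and $\mathbb C\{L\}$ has basis $e^\alpha$, $\alpha\in L$. **The space $V_L^T$.** Let $\hat{\mathfrak h}[\sigma]=\bigoplus_{n\in\frac1p\mathbb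 Z}\mathfrak h_{(pn)}\otimes t^n\oplus\mathbb C\mathbf k$ with $[x(m),y(n)]=\delta_{m+n,0}\,m\langle x,y\rangle\mathbf k$ and $\mathbf k$ central, and let $M(1)[\sigma]$ be the $\hat{\mathfrak h}[\sigma]$-module induced from the one-dimensional module on which $\mathbf k$ acts as $1$ and $x(n)$, $n\ge0$, as $0$; as a vector space it is the symmetric algebra on the $y(-n)$, $n\in\frac1p\mathbb Z_{>0}$, $y\in\mathfrak h_{(-pn)}$. Let $\hat L_\sigma=\{(\kappa^a,e_\alpha):a\in\mathbb Z/s\mathbb Z,\ \alpha\in L\}$ be the group with product $(\kappa^a,e_\alpha)(\kappa^b,e_\beta)=(\kappa^{a+b+\varepsilon_0^\sigma(\alpha,\beta)},e_{\alpha+\beta})$, where $$\varepsilon_0^\sigma(\alpha,\beta)=\varepsilon_0(\alpha,\beta)+\sum_{0<r<p/2}\Bigl(\frac s2+\frac{sr}p\Bigr)\langle\sigma^r\alpha,\beta\rangle+s\mathbb Z .$$ For a sublattice $Q\subset L$ let $\hat Q_\sigma\subset\hat L_\sigma$ be its preimage. Put $N=\{\alpha\in L:\langle\alpha,\mathfrak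 h_{(0)}\rangle=0\}$ and $M=(1-\sigma)L$. Let $T$ be a finite-dimensional irreducible complex $\hat N_\sigma$-module on which $\kappa=(\kappa^1,e_0)$ acts as the scalar $\xi$ and $\hat M_\sigma$ acts through a homomorphism $\tau:\hat M_\sigma\to\langle\xi\rangle\subset\mathbb C^\times$. Let $U_T=\operatorname{Ind}_{\hat N_\sigma}^{\hat L_\sigma}T$ and $V_L^T=M(1)[\sigma]\otimes U_T$. For $n\ne0$, $h(n)$ with $h\in\mathfrak h_{(pn)}$ acts on the factor $M(1)[\sigma]$; for $h\in\mathfrak h_{(0)}$, $h(0)$ acts on $M(1)[\sigma]\otimes g\cdot T$, $g=(\kappa^a,e_\beta)$, as the scalar $\langle h,\beta_{(0)}\rangle$; and $z^{\alpha_{(0)}}$ acts there as $z^{\langle\alpha_{(0)},\beta_{(0)}\rangle}$. **The twisted vertex operators** (Dong–Lepowsky). For $\alpha\in L$ let $$W(e^\alpha,z)=C_\alpha\,E^-_\sigma(-\alpha,z)\,E^+_\sigma(-\alpha,z)\,(\kappa^0,e_\alpha)\,z^{\alpha_{(0)}+\{\langle\alpha_{(0)},\alpha_{(0)}\rangle-\langle\alpha,\alpha\rangle\}/2},$$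 $$E^\pm_\sigma(-\alpha,z)=\exp\Bigl(\sum_{n\in\pm\frac1p\mathbb Z_{>0}}\frac{-\alpha_{(pn)}(n)}{n}z^{-n}\Bigr),\qquad C_\alpha=p^{-\langle\alpha,\alpha\rangle/2}\prod_{0<r<p/2}(1-\zeta^{r})^{\langle\sigma^r\alpha,\alpha\rangle}.$$ For $v=h_1(-n_1)\cdots h_k(-n_k)1\otimes e^\alpha$ let $W(v,z)$ be the normal ordered product $$W(v,z)={:}\prod_{i=1}^k\frac1{(n_i-1)!}\Bigl(\frac d{dz}\Bigr)^{n_i-1}h_i(z)\cdot W(e^\alpha,z){:},\qquad h(z)=\sum_{n\in\frac1p\mathbb Z}h_{(pn)}(n)z^{-n-1}$$ (modes $h(n)$ of the currents with $n<0$ to the left of $W(e^\alpha,z)$, those with $n\ge0$ to its right), extended linearly to $v\in V_L$. Finally let $Y_\sigma(v,z)=W(e^{\Delta_z}v,z)$, where $$\Delta_z=\sum_{m,n\ge0}\sum_{r=0}^{p-1}\sum_i c_{mnr}\,(\sigma^{-r}\beta_i)(m)\,\beta_i(n)\,z^{-m-n}$$ acts on $V_L$ (with $h(m)$, $m>0$,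 acting on $M(1)$ by the Heisenberg relations with $h(m)1=0$, and $h(0)e^\alpha=\langle h,\alpha\rangle e^\alpha$), $(\beta_i)$ is an orthonormal basis of $\mathfrak h$, and $$\sum_{m,n}c_{mnr}x^my^n=\frac12\log\frac{(1+x)^{1/p}-\zeta^{-r}(1+y)^{1/p}}{1-\zeta^{-r}}\quad(0<r<p),\qquad c_{mn0}=-\sum_{0<r<p}c_{mnr}.$$ Write $Y_\sigma(v,z)=\sum_{n\in\frac1p\mathbb Z}v_nz^{-n-1}$ with $v_n\in\operatorname{End}V_L^T$. A *$\sigma$-twisted $V_L$-submodule* of $V_L^T$ is a subspace stable under $v_n$ for all $v\in V_L$, $n\in\frac1p\mathbb Z$. **Lemma.** $V_L^T$, with the twisted vertex operators $Y_\sigma$, is irreducible: $V_L^T\neq0$, and its only $\sigma$-twisted $V_L$-submodules are $0$ and $V_L^T$. -/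

import Mathlib

open scoped TensorProduct
noncomputable section
namespace TwistedLattice

section SymmetricAlgebraTools

variable {E : Type*} [AddCommGroup E] [Module ℂ E]

/-- Extension of a linear map with pairwise commuting values in a (not necessarily commutative)
algebra to an algebra homomorphism on the symmetric algebra. -/
def symLift {A : Type*} [Ring A] [Algebra ℂ A] (f : E →ₗ[ℂ] A)
    (hf : ∀ x y, f x * f y = f y * f x) : SymmetricAlgebra ℂ E →ₐ[ℂ] A :=
  RingCon.liftₐ (TensorAlgebra.symRingCon ℂ E) (TensorAlgebra.lift ℂ f) <| by
    refine RingCon.ringConGen_le.2 fun x y h => ?_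
    induction h with
    | mul_comm x y =>
      rw [RingCon.ker_apply]
      simpa using hf x y

/-- Auxiliary: the algebra homomorphism `e ↦ e + d(e) ε` into the dual numbers. -/
def dualLift (d : E →ₗ[ℂ] ℂ) :
    SymmetricAlgebra ℂ E →ₐ[ℂ]
      TrivSqZeroExt (SymmetricAlgebra ℂ E) (SymmetricAlgebra ℂ E) :=
  SymmetricAlgebra.lift
    ((TrivSqZeroExt.inlAlgHom ℂ (SymmetricAlgebra ℂ E) (SymmetricAlgebra ℂ E)).toLinearMap ∘ₗ
        SymmetricAlgebra.ι ℂ E +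
      ((TrivSqZeroExt.inrHom (SymmetricAlgebra ℂ E) (SymmetricAlgebra ℂ E)).restrictScalars ℂ) ∘ₗ
        (Algebra.linearMap ℂ (SymmetricAlgebra ℂ E)) ∘ₗ d)

theorem dualLift_ι (d : E →ₗ[ℂ] ℂ) (e : E) : dualLift d (SymmetricAlgebra.ι ℂ E e) =
    TrivSqZeroExt.inl (SymmetricAlgebra.ι ℂ E e) +
      TrivSqZeroExt.inr (algebraMap ℂ (SymmetricAlgebra ℂ E) (d e)) := by
  unfold dualLift
  rw [SymmetricAlgebra.lift_ι_apply]
  rfl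

theorem fst_dualLift (d : E →ₗ[ℂ] ℂ) (s : SymmetricAlgebra ℂ E) :
    (dualLift d s).fst = s := by
  have : (TrivSqZeroExt.fstHom ℂ (SymmetricAlgebra ℂ E) (SymmetricAlgebra ℂ E)).comp
      (dualLift d) = AlgHom.id ℂ _ := by
    apply SymmetricAlgebra.algHom_ext
    ext e
    simp [dualLift_ι]
  exact congrArg (fun f => f s) this

/-- The unique derivation of the symmetric algebra extending a linear functional on the
generators. -/
def contract (d : E →ₗ[ℂ] ℂ) : Derivation ℂ (SymmetricAlgebra ℂ E) (SymmetricAlgebra ℂ E) :=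
  Derivation.mk'
    (((TrivSqZeroExt.sndHom (SymmetricAlgebra ℂ E) (SymmetricAlgebra ℂ E)).restrictScalars ℂ) ∘ₗ
      (dualLift d).toLinearMap) <| by
    intro a b
    simp [fst_dualLift, mul_comm]

theorem contract_ι (d : E →ₗ[ℂ] ℂ) (e : E) :
    contract d (SymmetricAlgebra.ι ℂ E e) = algebraMap ℂ _ (d e) := by
  simp [contract, dualLift_ι, Algebra.algebraMap_eq_smul_one]

theorem contract_comm (d d' : E →ₗ[ℂ] ℂ) (s : SymmetricAlgebra ℂ E) :
    contract d (contract d' s) = contract d' (contract d s) := by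
  induction s using SymmetricAlgebra.induction with
  | algebraMap r => simp
  | ι x => simp [contract_ι]
  | mul a b ha hb =>
    simp only [Derivation.leibniz, map_add, smul_eq_mul, ha, hb]
    ring
  | add a b ha hb => simp [ha, hb]

theorem contract_add (d d' : E →ₗ[ℂ] ℂ) (s : SymmetricAlgebra ℂ E) :
    contract (d + d') s = contract d s + contract d' s := by
  induction s using SymmetricAlgebra.induction with
  | algebraMap r => simp
  | ι x => simp [contract_ι]
  | mul a b ha hb =>
    simp only [Derivation.leibniz, smul_eq_mul, ha, hb]
    ring
  | add a b ha hb =>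
    simp only [map_add, ha, hb]
    ring

theorem contract_smul (c : ℂ) (d : E →ₗ[ℂ] ℂ) (s : SymmetricAlgebra ℂ E) :
    contract (c • d) s = c • contract d s := by
  induction s using SymmetricAlgebra.induction with
  | algebraMap r => simp
  | ι x => simp [contract_ι, Algebra.smul_def]
  | mul a b ha hb =>
    simp only [Derivation.leibniz, smul_eq_mul, ha, hb, Algebra.smul_def]
    ring
  | add a b ha hb => simp only [map_add, ha, hb, smul_add]

end SymmetricAlgebraTools

section Fock

variable (H : ℕ → Type*) [∀ m, AddCommGroup (H m)] [∀ m, Module ℂ (H m)]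

/-- The Fock space whose creation operators of depth `m + 1` are labelled by `H m`. -/
abbrev Fock : Type _ := SymmetricAlgebra ℂ (DirectSum ℕ H)

variable {H}

/-- The generator of the Fock space attached to a creation operator of depth `m + 1`. -/
def creator (m : ℕ) : H m →ₗ[ℂ] Fock H :=
  SymmetricAlgebra.ι ℂ (DirectSum ℕ H) ∘ₗ DirectSum.lof ℂ ℕ H m

/-- The annihilation operator of depth `m + 1`: the derivation of the Fock space given on the
generators by the linear functional `φ` in depth `m + 1` and by zero in all other depths. -/
def annihilator (m : ℕ) (φ : H m →ₗ[ℂ] ℂ) : Derivation ℂ (Fock H) (Fock H) :=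
  contract (φ ∘ₗ DirectSum.component ℂ ℕ H m)

/-- Auxiliary: the depth grading, as the homomorphism multiplying a generator of depth `m + 1` by
`X ^ (m + 1)`. -/
def depthHom : Fock H →ₐ[ℂ] Polynomial (Fock H) :=
  SymmetricAlgebra.lift
    (DirectSum.toModule ℂ ℕ (Polynomial (Fock H)) fun m =>
      ((Polynomial.monomial (R := Fock H) (m + 1)).restrictScalars ℂ) ∘ₗ creator m)

theorem depthHom_creator (m : ℕ) (x : H m) :
    depthHom (creator m x) = Polynomial.monomial (m + 1) (creator m x) := by
  simp [depthHom, creator]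

theorem eval_depthHom (s : Fock H) : (depthHom s).eval 1 = s := by
  have : (((Polynomial.aeval (R := Fock H) (1 : Fock H)).restrictScalars ℂ).comp
      (depthHom (H := H))) = AlgHom.id ℂ _ := by
    apply SymmetricAlgebra.algHom_ext
    ext m x
    have := depthHom_creator (H := H) m x
    simp only [creator, LinearMap.comp_apply] at this
    simp [this]
  have h := congrArg (fun f => f s) this
  simpa [Polynomial.aeval_def, Polynomial.eval₂_eq_eval_map] using h

theorem coeff_depthHom_annihilator (m : ℕ) (φ : H m →ₗ[ℂ] ℂ) (s : Fock H) (d : ℕ) :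
    (depthHom (annihilator m φ s)).coeff d =
      annihilator m φ ((depthHom s).coeff (d + (m + 1))) := by
  have key : ∀ s : Fock H, ∀ e : ℕ,
      (Polynomial.X ^ (m + 1) * depthHom (annihilator m φ s)).coeff e =
        annihilator m φ ((depthHom s).coeff e) := by
    intro s
    induction s using SymmetricAlgebra.induction with
    | algebraMap r =>
      intro e
      simp [AlgHom.commutes, Polynomial.algebraMap_apply, Polynomial.coeff_C]
      split_ifs <;> simp
    | ι x =>
      induction x using DirectSum.induction_on with
      | zero => intro e; simp
      | of n x =>
        intro e
        have h1 : SymmetricAlgebra.ι ℂ (DirectSum ℕ H) (DirectSum.of H n x) = creator n x := rfl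
        rw [h1, depthHom_creator]
        have h2 : annihilator m φ (creator n x) =
            algebraMap ℂ (Fock H) (φ (DirectSum.component ℂ ℕ H m (DirectSum.lof ℂ ℕ H n x))) :=
          contract_ι _ _
        rw [h2, AlgHom.commutes, Polynomial.algebraMap_apply, Polynomial.coeff_X_pow_mul',
          Polynomial.coeff_C, Polynomial.coeff_monomial]
        by_cases hnm : n = m
        · subst hnm
          by_cases he : n + 1 = e
          · subst he; simp [h2]
          · have : ¬ (n + 1 ≤ e ∧ e - (n + 1) = 0) := by omega
            rw [if_neg he, map_zero]
            by_cases h3 : n + 1 ≤ e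
            · rw [if_pos h3, if_neg (by omega)]
            · rw [if_neg h3]
        · have h4 : DirectSum.component ℂ ℕ H m (DirectSum.lof ℂ ℕ H n x) = 0 := by
            rw [DirectSum.component.of]; simp [hnm]
          split_ifs <;> simp [h2, h4]
      | add x y hx hy =>
        intro e
        simp only [map_add, mul_add, Polynomial.coeff_add, hx, hy]
    | mul a b ha hb =>
      intro e
      have h5 : (Polynomial.X ^ (m + 1) * depthHom (annihilator m φ (a * b))) =
          depthHom a * (Polynomial.X ^ (m + 1) * depthHom (annihilator m φ b)) +
            depthHom b * (Polynomial.X ^ (m + 1) * depthHom (annihilator m φ a)) := by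
        simp only [Derivation.leibniz, smul_eq_mul, map_add, map_mul]
        ring
      rw [h5, Polynomial.coeff_add, Polynomial.coeff_mul, Polynomial.coeff_mul, map_mul,
        Polynomial.coeff_mul, map_sum]
      simp only [ha, hb, Derivation.leibniz, smul_eq_mul, Finset.sum_add_distrib]
      congr 1
      rw [← Finset.Nat.sum_antidiagonal_swap]
      rfl
    | add a b ha hb =>
      intro e
      simp only [map_add, mul_add, Polynomial.coeff_add, ha, hb]
  rw [← key s (d + (m + 1)), Polynomial.coeff_X_pow_mul]

variable (H) in
/-- The subspace of the Fock space of elements of depth at most `D`. -/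
def fockFil (D : ℤ) : Submodule ℂ (Fock H) where
  carrier := {s | ∀ d : ℕ, D < d → (depthHom s).coeff d = 0}
  add_mem' := by
    intro a b ha hb d hd
    simp [ha d hd, hb d hd]
  zero_mem' := by intro d _; simp
  smul_mem' := by
    intro c a ha d hd
    simp [ha d hd]

theorem annihilator_mem (m : ℕ) (φ : H m →ₗ[ℂ] ℂ) (D : ℤ) (s : Fock H) (hs : s ∈ fockFil H D) :
    annihilator m φ s ∈ fockFil H (D - (m + 1)) := by
  intro d hd
  rw [coeff_depthHom_annihilator, hs _ (by push_cast; linarith), map_zero]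

theorem annihilator_add (m : ℕ) (φ ψ : H m →ₗ[ℂ] ℂ) (s : Fock H) :
    annihilator m (φ + ψ) s = annihilator m φ s + annihilator m ψ s := by
  rw [annihilator, LinearMap.add_comp, contract_add]
  rfl

theorem annihilator_smul (m : ℕ) (c : ℂ) (φ : H m →ₗ[ℂ] ℂ) (s : Fock H) :
    annihilator m (c • φ) s = c • annihilator m φ s := by
  rw [annihilator, LinearMap.smul_comp, contract_smul]
  rfl

/-- The algebra homomorphism on the Fock space given by pairwise commuting elements. -/
def fockLift {A : Type*} [Ring A] [Algebra ℂ A] (f : ∀ m, H m →ₗ[ℂ] A)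
    (hf : ∀ m n x y, f m x * f n y = f n y * f m x) : Fock H →ₐ[ℂ] A :=
  symLift (DirectSum.toModule ℂ ℕ A f) <| by
    intro x y
    have e : ∀ (n : ℕ) (h : H n), DirectSum.toModule ℂ ℕ A f (DirectSum.of H n h) = f n h :=
      fun n h => DirectSum.toModule_lof ℂ n h
    induction x using DirectSum.induction_on with
    | zero => simp
    | add x x' hx hx' => rw [map_add, add_mul, mul_add, hx, hx']
    | of m h =>
      induction y using DirectSum.induction_on with
      | zero => simp
      | add y y' hy hy' => rw [map_add, add_mul, mul_add, hy, hy']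
      | of n h' => rw [e, e, hf]

end Fock

section Lowering

/-- An exhaustive increasing filtration by subspaces which vanishes in negative degrees. -/
structure IsFil {X : Type*} [AddCommGroup X] [Module ℂ X] (G : ℤ → Submodule ℂ X) : Prop where
  mono : Monotone G
  neg : ∀ D < 0, ∀ x ∈ G D, x = 0
  exhaust : ∀ x, ∃ D, x ∈ G D

/-- The linear map `f` lowers the filtration `G` by `k`. -/
def Lowers {X : Type*} [AddCommGroup X] [Module ℂ X] (G : ℤ → Submodule ℂ X)
    (k : ℤ) (f : Module.End ℂ X) : Prop :=
  ∀ D, ∀ x ∈ G D, f x ∈ G (D - k)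

variable {X : Type*} [AddCommGroup X] [Module ℂ X] {G : ℤ → Submodule ℂ X}

theorem Lowers.mul {k l : ℤ} {f g : Module.End ℂ X} (hf : Lowers G k f) (hg : Lowers G l g) :
    Lowers G (k + l) (f * g) := by
  intro D x hx
  have := hf _ _ (hg _ _ hx)
  rwa [show D - (k + l) = D - l - k by ring]

theorem Lowers.sum {ι : Type*} (s : Finset ι) {k : ℤ} {f : ι → Module.End ℂ X}
    (hf : ∀ i ∈ s, Lowers G k (f i)) : Lowers G k (∑ i ∈ s, f i) := by
  intro D x hx
  rw [LinearMap.sum_apply]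
  exact Submodule.sum_mem _ fun i hi => hf i hi D x hx

theorem Lowers.smul {k : ℤ} {f : Module.End ℂ X} (c : ℂ) (hf : Lowers G k f) :
    Lowers G k (c • f) := fun D x hx => Submodule.smul_mem _ _ (hf D x hx)

/-- A sequence of operators (the coefficients of a formal series) is locally finite if each vector
is killed by almost all of them. -/
def LocFin {X Y : Type*} [AddCommGroup X] [Module ℂ X] [AddCommGroup Y] [Module ℂ Y]
    {ι : Type*} (f : ι → X →ₗ[ℂ] Y) : Prop :=
  ∀ x, {i | f i x ≠ 0}.Finite

/-- The sum of a locally finite family of operators. -/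
def locSum {X Y : Type*} [AddCommGroup X] [Module ℂ X] [AddCommGroup Y] [Module ℂ Y]
    {ι : Type*} (f : ι → X →ₗ[ℂ] Y) (hf : LocFin f) : X →ₗ[ℂ] Y where
  toFun x := ∑ᶠ i, f i x
  map_add' x y := by
    rw [← finsum_add_distrib (hf x) (hf y)]
    simp
  map_smul' c x := by
    rw [RingHom.id_apply, smul_finsum]
    simp

theorem locSum_apply {X Y : Type*} [AddCommGroup X] [Module ℂ X] [AddCommGroup Y] [Module ℂ Y]
    {ι : Type*} (f : ι → X →ₗ[ℂ] Y) (hf : LocFin f) (x : X) : locSum f hf x = ∑ᶠ i, f i x := rfl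

theorem LocFin.comp {X Y Z : Type*} [AddCommGroup X] [Module ℂ X] [AddCommGroup Y] [Module ℂ Y]
    [AddCommGroup Z] [Module ℂ Z] {ι : Type*} {f : ι → X →ₗ[ℂ] Y} (hf : LocFin f)
    (g : ι → Y →ₗ[ℂ] Z) : LocFin fun i => g i ∘ₗ f i := fun x =>
  (hf x).subset fun i hi h0 => hi ((congrArg (g i) h0).trans (map_zero (g i)))

theorem LocFin.of_lowers (hG : IsFil G) {f : ℕ → Module.End ℂ X} (hf : ∀ j : ℕ, Lowers G j (f j)) :
    LocFin f := by
  intro x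
  obtain ⟨D, hD⟩ := hG.exhaust x
  refine (Set.finite_Iic D.toNat).subset fun j hj => ?_
  by_contra hlt
  simp only [Set.mem_Iic, not_le] at hlt
  exact hj (hG.neg (D - j) (by omega) _ (hf j D x hD))

/-- The exponential `∑ f ^ q / q!` of a formal power series `f` without constant term, with
coefficients in a (not necessarily commutative) algebra of operators. (The summands with `q > k`
do not contribute to the `k`-th coefficient.) -/
def expCoeff (f : PowerSeries (Module.End ℂ X)) (k : ℕ) : Module.End ℂ X :=
  ∑ q ∈ Finset.range (k + 1), ((q.factorial : ℂ)⁻¹) • PowerSeries.coeff k (f ^ q)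

theorem Lowers.expCoeff {f : PowerSeries (Module.End ℂ X)}
    (hf : ∀ j : ℕ, Lowers G j (PowerSeries.coeff j f)) (k : ℕ) :
    Lowers G k (expCoeff f k) := by
  have hp : ∀ q k : ℕ, Lowers G k (PowerSeries.coeff k (f ^ q)) := by
    intro q
    induction q with
    | zero =>
      intro k D x hx
      rw [pow_zero, PowerSeries.coeff_one]
      split_ifs with h
      · subst h; simpa using hx
      · simp
    | succ q ih =>
      intro k
      rw [pow_succ, PowerSeries.coeff_mul]
      refine Lowers.sum _ fun ij hij => ?_
      have : (k : ℤ) = (ij.1 : ℤ) + ij.2 := by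
        rw [← Finset.HasAntidiagonal.mem_antidiagonal.1 hij]; push_cast; ring
      rw [this]
      exact (ih _).mul (hf _)
  exact Lowers.sum _ fun q _ => (hp q k).smul _

theorem isFil_fock (H : ℕ → Type*) [∀ m, AddCommGroup (H m)] [∀ m, Module ℂ (H m)] :
    IsFil (fockFil H) where
  mono := fun D D' h s hs d hd => hs d (lt_of_le_of_lt h hd)
  neg := by
    intro D hD s hs
    have : depthHom s = 0 := Polynomial.ext fun d => by
      rw [hs d (by omega)]; simp
    rw [← eval_depthHom s, this, Polynomial.eval_zero]
  exhaust := fun s => ⟨(depthHom s).natDegree, fun d hd =>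
    Polynomial.coeff_eq_zero_of_natDegree_lt (by exact_mod_cast hd)⟩

/-- The filtration of `X ⊗ U` induced by a filtration of `X`. -/
def tensorFil (G : ℤ → Submodule ℂ X) (U : Type*) [AddCommGroup U] [Module ℂ U] (D : ℤ) :
    Submodule ℂ (X ⊗[ℂ] U) :=
  Submodule.span ℂ {w | ∃ x ∈ G D, ∃ u, w = x ⊗ₜ[ℂ] u}

theorem isFil_tensor (hG : IsFil G) (U : Type*) [AddCommGroup U] [Module ℂ U] :
    IsFil (tensorFil G U) where
  mono := by
    intro D D' h
    refine Submodule.span_mono ?_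
    rintro _ ⟨x, hx, u, rfl⟩
    exact ⟨x, hG.mono h hx, u, rfl⟩
  neg := by
    intro D hD w hw
    have : tensorFil G U D ≤ ⊥ := by
      refine Submodule.span_le.2 ?_
      rintro _ ⟨x, hx, u, rfl⟩
      simp [hG.neg D hD x hx]
    simpa using this hw
  exhaust := by
    intro w
    induction w using TensorProduct.induction_on with
    | zero => exact ⟨0, Submodule.zero_mem _⟩
    | tmul x u =>
      obtain ⟨D, hD⟩ := hG.exhaust x
      exact ⟨D, Submodule.subset_span ⟨x, hD, u, rfl⟩⟩
    | add a b ha hb =>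
      obtain ⟨D, hD⟩ := ha
      obtain ⟨D', hD'⟩ := hb
      have hm : Monotone (tensorFil G U) := by
        intro D D' h
        refine Submodule.span_mono ?_
        rintro _ ⟨x, hx, u, rfl⟩
        exact ⟨x, hG.mono h hx, u, rfl⟩
      exact ⟨max D D', Submodule.add_mem _ (hm (le_max_left _ _) hD) (hm (le_max_right _ _) hD')⟩

theorem Lowers.tensor {U : Type*} [AddCommGroup U] [Module ℂ U] {k : ℤ} {f : Module.End ℂ X}
    (hf : Lowers G k f) (g : Module.End ℂ U) :
    Lowers (tensorFil G U) k (TensorProduct.map f g) := by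
  intro D w hw
  have : tensorFil G U D ≤ (tensorFil G U (D - k)).comap (TensorProduct.map f g) := by
    refine Submodule.span_le.2 ?_
    rintro _ ⟨x, hx, u, rfl⟩
    exact Submodule.subset_span ⟨f x, hf D x hx, g u, by simp⟩
  exact this hw

theorem map_mul_comm {U : Type*} [AddCommGroup U] [Module ℂ U] {f f' : Module.End ℂ X}
    {g g' : Module.End ℂ U} (hf : f * f' = f' * f) (hg : g * g' = g' * g) :
    (TensorProduct.map f g : Module.End ℂ (X ⊗[ℂ] U)) * TensorProduct.map f' g' =
      TensorProduct.map f' g' * TensorProduct.map f g := by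
  rw [← TensorProduct.map_mul, ← TensorProduct.map_mul, hf, hg]

end Lowering

section Fields

/-- The space of fields on `X`: series `∑ₖ Fₖ xᵏ` with coefficients in `End X` such that `F(x) w`
has only finitely many negative powers of `x`, for each vector `w`. -/
def FieldSpace (X : Type*) [AddCommGroup X] [Module ℂ X] : Submodule ℂ (ℤ → Module.End ℂ X) where
  carrier := {F | ∀ w, ∃ N : ℤ, ∀ k < N, F k w = 0}
  add_mem' := by
    intro F F' h h' w
    obtain ⟨N, hN⟩ := h w
    obtain ⟨N', hN'⟩ := h' w
    exact ⟨min N N', fun k hk => by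
      simp [hN k (lt_of_lt_of_le hk (min_le_left _ _)),
        hN' k (lt_of_lt_of_le hk (min_le_right _ _))]⟩
  zero_mem' := fun w => ⟨0, fun k _ => rfl⟩
  smul_mem' := by
    intro c F h w
    obtain ⟨N, hN⟩ := h w
    exact ⟨N, fun k hk => by simp [hN k hk]⟩

variable {X : Type*} [AddCommGroup X] [Module ℂ X]

instance fieldSpaceAddCommGroup : AddCommGroup (FieldSpace X) := inferInstance

instance fieldSpaceEndRing : Ring (Module.End ℂ (FieldSpace X)) := inferInstance

instance fieldSpaceEndAlgebra : Algebra ℂ (Module.End ℂ (FieldSpace X)) := inferInstance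

/-- Multiplication of a field by `x ^ (-c)`. -/
def fieldShift (c : ℤ) : FieldSpace X →ₗ[ℂ] FieldSpace X where
  toFun F := ⟨fun k => F.1 (k + c), fun w => by
    obtain ⟨N, hN⟩ := F.2 w
    exact ⟨N - c, fun k hk => hN _ (by linarith)⟩⟩
  map_add' _ _ := rfl
  map_smul' _ _ := rfl

/-- A current `∑ⱼ aⱼ x ^ (-j)`: every vector is killed by `aⱼ` for all large `j`. -/
def IsCurrent (a : ℤ → Module.End ℂ X) : Prop := ∀ w, ∃ J : ℤ, ∀ j, J ≤ j → a j w = 0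

/-- The contribution of the mode `aⱼ` to the coefficient of `xᵏ` in the normal ordered product
`: (∑ⱼ aⱼ x ^ (-j - c)) F(x) :`, where modes with `j < 0` act after `F` and modes with `0 ≤ j`
act before `F`. -/
def normalTerm (a : ℤ → Module.End ℂ X) (c : ℤ) (F : ℤ → Module.End ℂ X) (k j : ℤ) :
    Module.End ℂ X :=
  if j < 0 then a j * F (k + j + c) else F (k + j + c) * a j

theorem normalTerm_trunc {a : ℤ → Module.End ℂ X} (ha : IsCurrent a) (c : ℤ) (F : FieldSpace X)
    (w : X) : ∃ N : ℤ, ∀ k < N, ∀ j, normalTerm a c F.1 k j w = 0 := by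
  obtain ⟨J, hJ⟩ := ha w
  obtain ⟨N, hN⟩ := F.2 w
  choose M hM using fun j => F.2 (a j w)
  have : ∃ B : ℤ, ∀ j ∈ Finset.Ico 0 J, B ≤ M j - j - c := by
    obtain ⟨B, hB⟩ := ((Finset.Ico 0 J).image fun j => M j - j - c).bddBelow
    exact ⟨B, fun j hj => hB (by
      simp only [Finset.coe_image]; exact ⟨j, hj, rfl⟩)⟩
  obtain ⟨B, hB⟩ := this
  refine ⟨min (N - c) B, fun k hk j => ?_⟩
  have h1 : k < N - c := lt_of_lt_of_le hk (min_le_left _ _)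
  have h2 : k < B := lt_of_lt_of_le hk (min_le_right _ _)
  unfold normalTerm
  split_ifs with hj
  · simp [hN (k + j + c) (by linarith)]
  · by_cases hjJ : J ≤ j
    · simp [hJ j hjJ]
    · have := hB j (Finset.mem_Ico.2 ⟨by omega, by omega⟩)
      exact hM j _ (by linarith)

theorem normalTerm_finite {a : ℤ → Module.End ℂ X} (ha : IsCurrent a) (c : ℤ) (F : FieldSpace X)
    (k : ℤ) : LocFin (normalTerm a c F.1 k) := by
  intro w
  obtain ⟨J, hJ⟩ := ha w
  obtain ⟨N, hN⟩ := F.2 w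
  refine (Set.finite_Ico (min (N - c - k) 0) (max J 0)).subset fun j hj => ?_
  change normalTerm a c F.1 k j w ≠ 0 at hj
  rw [normalTerm] at hj
  split_ifs at hj with h
  · refine Set.mem_Ico.2 ⟨(min_le_left _ _).trans ?_, lt_of_lt_of_le h (le_max_right _ _)⟩
    by_contra hlt
    exact hj (by simp [hN (k + j + c) (by linarith)])
  · refine Set.mem_Ico.2 ⟨(min_le_right _ _).trans (by omega), lt_of_lt_of_le ?_ (le_max_left _ _)⟩
    by_contra hlt
    exact hj (by simp [hJ j (by linarith)])

/-- The normal ordered product `F ↦ : a(x) F(x) :` with the current `a(x) = ∑ⱼ aⱼ x ^ (-j - c)`,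
that is `a⁻(x) F(x) + F(x) a⁺(x)`, where `a⁻` collects the modes `aⱼ` with `j < 0`, and `a⁺`
those with `0 ≤ j`. -/
def normalProduct (a : ℤ → Module.End ℂ X) (ha : IsCurrent a) (c : ℤ) :
    FieldSpace X →ₗ[ℂ] FieldSpace X where
  toFun F := ⟨fun k => locSum (normalTerm a c F.1 k) (normalTerm_finite ha c F k), fun w => by
    obtain ⟨N, hN⟩ := normalTerm_trunc ha c F w
    refine ⟨N, fun k hk => ?_⟩
    rw [locSum_apply]
    simp [hN k hk]⟩
  map_add' F F' := by
    ext k w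
    simp only [Submodule.coe_add, Pi.add_apply, LinearMap.add_apply, locSum_apply]
    rw [← finsum_add_distrib (normalTerm_finite ha c F k w) (normalTerm_finite ha c F' k w)]
    refine finsum_congr fun j => ?_
    unfold normalTerm
    split_ifs <;> simp
  map_smul' r F := by
    ext k w
    simp only [SetLike.val_smul, Pi.smul_apply, LinearMap.smul_apply, locSum_apply,
      RingHom.id_apply]
    rw [smul_finsum]
    refine finsum_congr fun j => ?_
    unfold normalTerm
    split_ifs <;> simp

theorem normalProduct_apply (a : ℤ → Module.End ℂ X) (ha : IsCurrent a) (c : ℤ)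
    (F : FieldSpace X) (k : ℤ) (w : X) :
    (normalProduct a ha c F).1 k w = ∑ᶠ j, normalTerm a c F.1 k j w := rfl

theorem finsum_swap {Y : Type*} [AddCommGroup Y] (T : ℤ → ℤ → Y)
    (h1 : {i | ∃ j, T i j ≠ 0}.Finite) (h2 : ∀ i, {j | T i j ≠ 0}.Finite) :
    ∑ᶠ i, ∑ᶠ j, T i j = ∑ᶠ j, ∑ᶠ i, T i j := by
  set S := h1.toFinset
  set R := S.biUnion fun i => (h2 i).toFinset
  have hS : ∀ i j, T i j ≠ 0 → i ∈ S := fun i j h => h1.mem_toFinset.2 ⟨j, h⟩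
  have hR : ∀ i j, T i j ≠ 0 → j ∈ R := fun i j h =>
    Finset.mem_biUnion.2 ⟨i, hS i j h, (h2 i).mem_toFinset.2 h⟩
  have e1 : ∀ i, ∑ᶠ j, T i j = ∑ j ∈ R, T i j := fun i =>
    finsum_eq_sum_of_support_subset _ fun j hj => hR i j hj
  have e2 : ∀ j, ∑ᶠ i, T i j = ∑ i ∈ S, T i j := fun j =>
    finsum_eq_sum_of_support_subset _ fun i hi => hS i j hi
  simp only [e1, e2]
  rw [finsum_eq_sum_of_support_subset (s := S), finsum_eq_sum_of_support_subset (s := R),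
    Finset.sum_comm]
  · intro j hj
    obtain ⟨i, -, hi⟩ := Finset.exists_ne_zero_of_sum_ne_zero hj
    exact hR i j hi
  · intro i hi
    obtain ⟨j, -, hj⟩ := Finset.exists_ne_zero_of_sum_ne_zero hi
    exact hS i j hj

/-- Auxiliary: the summands of an iterated normal ordered product. -/
def doubleTerm (a b : ℤ → Module.End ℂ X) (c d : ℤ) (F : ℤ → Module.End ℂ X) (k i j : ℤ) :
    Module.End ℂ X :=
  if i < 0 then a i * normalTerm b d F (k + i + c) j
  else normalTerm b d F (k + i + c) j * a i

theorem normalProduct_normalProduct (a b : ℤ → Module.End ℂ X) (ha : IsCurrent a)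
    (hb : IsCurrent b) (c d : ℤ) (F : FieldSpace X) (k : ℤ) (w : X) :
    (normalProduct a ha c (normalProduct b hb d F)).1 k w =
      ∑ᶠ i, ∑ᶠ j, doubleTerm a b c d F.1 k i j w := by
  rw [normalProduct_apply]
  refine finsum_congr fun i => ?_
  unfold doubleTerm
  rw [normalTerm]
  split_ifs with h
  · rw [Module.End.mul_apply, normalProduct_apply]
    exact (a i).toAddMonoidHom.map_finsum (normalTerm_finite hb d F _ w)
  · rw [Module.End.mul_apply, normalProduct_apply]
    rfl

theorem normalProduct_comm (a b : ℤ → Module.End ℂ X) (ha : IsCurrent a) (hb : IsCurrent b)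
    (c d : ℤ) (hneg : ∀ i < 0, ∀ j < 0, a i * b j = b j * a i)
    (hpos : ∀ i, 0 ≤ i → ∀ j, 0 ≤ j → a i * b j = b j * a i) :
    normalProduct a ha c * normalProduct b hb d = normalProduct b hb d * normalProduct a ha c := by
  ext F k w
  rw [Module.End.mul_apply, Module.End.mul_apply, normalProduct_normalProduct,
    normalProduct_normalProduct, finsum_swap]
  · refine finsum_congr fun j => finsum_congr fun i => ?_
    congr 1
    have e : k + i + c + j + d = k + j + d + i + c := by ring
    unfold doubleTerm normalTerm
    rw [e]
    split_ifs with hi hj hj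
    · rw [← mul_assoc, ← mul_assoc, hneg i hi j hj]
    · rw [mul_assoc]
    · rw [mul_assoc]
    · rw [mul_assoc, mul_assoc, hpos i (by omega) j (by omega)]
  · obtain ⟨J, hJ⟩ := ha w
    obtain ⟨N, hN⟩ := normalTerm_trunc hb d F w
    refine (Set.finite_Ico (min (N - k - c) 0) (max J 0)).subset ?_
    rintro i ⟨j, hj⟩
    unfold doubleTerm at hj
    split_ifs at hj with hi
    · refine Set.mem_Ico.2 ⟨(min_le_left _ _).trans ?_, lt_of_lt_of_le hi (le_max_right _ _)⟩
      by_contra hlt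
      exact hj (by simp [hN (k + i + c) (by linarith)])
    · refine Set.mem_Ico.2 ⟨(min_le_right _ _).trans (by omega),
        lt_of_lt_of_le ?_ (le_max_left _ _)⟩
      by_contra hlt
      exact hj (by simp [hJ i (by linarith)])
  · intro i
    unfold doubleTerm
    split_ifs with hi
    · refine (normalTerm_finite hb d F (k + i + c) w).subset fun j hj => ?_
      intro h0
      exact hj (by simp [h0])
    · exact normalTerm_finite hb d F (k + i + c) (a i w)

/-- The normal ordered product as a linear map in the current, for a linear family of currents. -/
def normalProductLin {E : Type*} [AddCommGroup E] [Module ℂ E] (a : E → ℤ → Module.End ℂ X)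
    (ha : ∀ h, IsCurrent (a h)) (hadd : ∀ h h' j, a (h + h') j = a h j + a h' j)
    (hsmul : ∀ (r : ℂ) h j, a (r • h) j = r • a h j) (c : ℤ) :
    E →ₗ[ℂ] Module.End ℂ (FieldSpace X) where
  toFun h := normalProduct (a h) (ha h) c
  map_add' h h' := by
    ext F k w
    change (normalProduct (a (h + h')) (ha _) c F).1 k w =
      (normalProduct (a h) (ha h) c F).1 k w + (normalProduct (a h') (ha h') c F).1 k w
    simp only [normalProduct_apply]
    rw [← finsum_add_distrib (normalTerm_finite (ha h) _ F k w)
      (normalTerm_finite (ha h') _ F k w)]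
    refine finsum_congr fun j => ?_
    unfold normalTerm
    rw [hadd]
    split_ifs <;> simp
  map_smul' r h := by
    ext F k w
    change (normalProduct (a (r • h)) (ha _) c F).1 k w = r • (normalProduct (a h) (ha h) c F).1 k w
    simp only [normalProduct_apply]
    rw [smul_finsum]
    refine finsum_congr fun j => ?_
    unfold normalTerm
    rw [hsmul]
    split_ifs <;> simp

/-- The field `A(x) G(x) x ^ d`, for a power series `A(x) = ∑ Aᵢ xⁱ` and a locally finite series
`G(x) = ∑ G₍ⱼ,ₗ₎ x ^ (l - j)`. The summand of index `(j, l)` contributes to the coefficient of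
`xᵏ` through `Aᵢ` with `i - j + l + d = k`, provided that `0 ≤ i`. -/
def glueField (A : ℕ → Module.End ℂ X) (G : ℕ × ℤ → Module.End ℂ X) (hG : LocFin G) (d : ℤ) :
    FieldSpace X :=
  ⟨fun k => locSum
    (fun t => if 0 ≤ k + t.1 - t.2 - d then A (k + t.1 - t.2 - d).toNat * G t else 0)
    (fun w => (hG w).subset fun t ht h0 => ht (by
      dsimp only
      split_ifs <;> simp [h0])), fun w => by
    have : ∃ B : ℤ, ∀ t ∈ (hG w).toFinset, B ≤ t.2 - t.1 + d := by
      obtain ⟨B, hB⟩ := ((hG w).toFinset.image fun t => t.2 - t.1 + d).bddBelow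
      exact ⟨B, fun j hj => hB (by
        simp only [Finset.coe_image]; exact ⟨j, hj, rfl⟩)⟩
    obtain ⟨B, hB⟩ := this
    refine ⟨B, fun k hk => ?_⟩
    refine (locSum_apply _ _ w).trans ?_
    refine (finsum_congr fun t => ?_).trans finsum_zero
    by_cases h0 : G t w = 0
    · split_ifs <;> simp [h0]
    · have := hB t ((hG w).mem_toFinset.2 h0)
      rw [if_neg (by linarith)]
      rfl⟩

end Fields

/-- A positive-definite even lattice `L` with an automorphism `σ` of odd order `p`, a primitive
root of unity `ξ` of order `s = 2p`, and a normalized `σ`-invariant 2-cocycle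
`ε₀ : L × L → ℤ/sℤ` with commutator map `(α, β) ↦ (s/2)⟨α, β⟩ + sℤ`. -/
structure LatticeDatum (L : Type*) [AddCommGroup L] where
  form : LinearMap.BilinForm ℤ L
  form_symm : ∀ α β, form α β = form β α
  form_even : ∀ α, Even (form α α)
  form_pos : ∀ α, α ≠ 0 → 0 < form α α
  σ : L ≃ₗ[ℤ] L
  form_σ : ∀ α β, form (σ α) (σ β) = form α β
  odd_order : Odd (orderOf σ)
  ξ : ℂ
  ξ_primitive : IsPrimitiveRoot ξ (2 * orderOf σ)
  ε₀ : L → L → ZMod (2 * orderOf σ)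
  ε₀_cocycle : ∀ α β γ, ε₀ α β + ε₀ (α + β) γ = ε₀ β γ + ε₀ α (β + γ)
  ε₀_zero_left : ∀ α, ε₀ 0 α = 0
  ε₀_zero_right : ∀ α, ε₀ α 0 = 0
  ε₀_commutator : ∀ α β, ε₀ α β - ε₀ β α = ((orderOf σ * form α β : ℤ) : ZMod (2 * orderOf σ))
  ε₀_σ : ∀ α β, ε₀ (σ α) (σ β) = ε₀ α β

namespace LatticeDatum

variable {L : Type*} [AddCommGroup L] (D : LatticeDatum L)

/-- The order of `σ`. -/
def p : ℕ := orderOf D.σ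

/-- The primitive `p`-th root of unity `ζ = ξ²`. -/
def ζ : ℂ := D.ξ ^ 2

/-- The integer `⟨σʳ α, β⟩`. -/
def pairing (r : ℕ) (α β : L) : ℤ := D.form ((D.σ ^ r) α) β

theorem p_pos : 0 < D.p := D.odd_order.pos

theorem σ_pow_p : D.σ ^ D.p = 1 := pow_orderOf_eq_one _

theorem ζ_pow_p : D.ζ ^ D.p = 1 := by
  rw [ζ, ← pow_mul]
  exact D.ξ_primitive.pow_eq_one

theorem ζ_ne_zero : D.ζ ≠ 0 :=
  pow_ne_zero _ (D.ξ_primitive.ne_zero (by have := D.p_pos; unfold p at this; omega))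

section Cartan

/-- The complexification `𝔥 = ℂ ⊗ L`. -/
abbrev Cartan (L : Type*) [AddCommGroup L] : Type _ := ℂ ⊗[ℤ] L

/-- The complex bilinear extension of the form to `𝔥`. -/
def formC : LinearMap.BilinForm ℂ (Cartan L) := LinearMap.BilinForm.baseChange ℂ D.form

/-- The complex linear extension of `σ` to `𝔥`. -/
def σC : Module.End ℂ (Cartan L) := LinearMap.baseChange ℂ (D.σ : L →ₗ[ℤ] L)

theorem σC_pow_p : D.σC ^ D.p = 1 := by
  have : ∀ n : ℕ, D.σC ^ n = LinearMap.baseChange ℂ ((D.σ ^ n : L ≃ₗ[ℤ] L) : L →ₗ[ℤ] L) := by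
    intro n
    induction n with
    | zero => ext x; simp
    | succ n ih => rw [pow_succ, ih]; ext x; simp [σC, pow_succ]
  rw [this, D.σ_pow_p]
  ext x
  simp

/-- The eigenspace `𝔥₍ₙ₎ = {h | σ h = ζⁿ h}`. -/
def eig (n : ℤ) : Submodule ℂ (Cartan L) := Module.End.eigenspace D.σC (D.ζ ^ n)

/-- The projection `h ↦ h₍ₙ₎ = (1/p) ∑ᵣ ζ ^ (-n r) σʳ h` of `𝔥` onto `𝔥₍ₙ₎`. -/
def proj (n : ℤ) : Cartan L →ₗ[ℂ] D.eig n :=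
  LinearMap.codRestrict (D.eig n)
    ((D.p : ℂ)⁻¹ • ∑ r ∈ Finset.range D.p, (D.ζ ^ (-n * r)) • D.σC ^ r) <| by
    intro h
    rw [eig, Module.End.mem_eigenspace_iff]
    simp only [LinearMap.smul_apply, LinearMap.sum_apply, map_smul, map_sum]
    rw [smul_comm]
    congr 1
    have e : ∀ r : ℕ, D.ζ ^ (-n * r) • D.σC ((D.σC ^ r) h) =
        D.ζ ^ n • (D.ζ ^ (-n * ((r + 1 : ℕ) : ℤ)) • (D.σC ^ (r + 1)) h) := by
      intro r
      rw [smul_smul, ← zpow_add₀ D.ζ_ne_zero, pow_succ', Module.End.mul_apply]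
      congr 2
      push_cast
      ring
    simp only [e, ← Finset.smul_sum]
    congr 1
    have h1 := Finset.sum_range_succ (fun r : ℕ => D.ζ ^ (-n * (r : ℤ)) • (D.σC ^ r) h) D.p
    rw [Finset.sum_range_succ'] at h1
    have h2 : D.ζ ^ (-n * (D.p : ℤ)) = 1 := by
      rw [mul_comm, zpow_mul, zpow_natCast, D.ζ_pow_p, one_zpow]
    rw [h2, D.σC_pow_p] at h1
    simpa using h1

end Cartan

section Extension

/-- The exponent `∑_{0 < r < p/2} (s/2 + sr/p) ⟨σʳ α, β⟩` with `s = 2p`. -/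
def cocycleShift (α β : L) : ℤ :=
  ∑ r ∈ Finset.Icc 1 ((D.p - 1) / 2), ((D.p : ℤ) + 2 * r) * D.pairing r α β

/-- The 2-cocycle `ε₀^σ`. -/
def εσ (α β : L) : ZMod (2 * orderOf D.σ) := D.ε₀ α β + (D.cocycleShift α β : ℤ)

theorem εσ_cocycle (α β γ : L) :
    D.εσ α β + D.εσ (α + β) γ = D.εσ β γ + D.εσ α (β + γ) := by
  have h := D.ε₀_cocycle α β γ
  have h1 : D.cocycleShift (α + β) γ = D.cocycleShift α γ + D.cocycleShift β γ := by
    simp [cocycleShift, pairing, mul_add, Finset.sum_add_distrib]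
  have h2 : D.cocycleShift α (β + γ) = D.cocycleShift α β + D.cocycleShift α γ := by
    simp [cocycleShift, pairing, mul_add, Finset.sum_add_distrib]
  simp only [εσ, h1, h2, Int.cast_add]
  linear_combination h

theorem εσ_zero_left (α : L) : D.εσ 0 α = 0 := by
  simp [εσ, cocycleShift, pairing, D.ε₀_zero_left]

theorem εσ_zero_right (α : L) : D.εσ α 0 = 0 := by
  simp [εσ, cocycleShift, pairing, D.ε₀_zero_right]

/-- The central extension `L̂_σ` of `L` by `ℤ/sℤ`: the pair `⟨a, α⟩` stands for `(κᵃ, e_α)`. -/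
@[ext]
structure Ext (D : LatticeDatum L) where
  central : ZMod (2 * orderOf D.σ)
  bar : L

instance : Mul D.Ext := ⟨fun g h => ⟨g.central + h.central + D.εσ g.bar h.bar, g.bar + h.bar⟩⟩

instance : One D.Ext := ⟨⟨0, 0⟩⟩

instance : Inv D.Ext := ⟨fun g => ⟨-g.central - D.εσ (-g.bar) g.bar, -g.bar⟩⟩

theorem Ext.mul_def (g h : D.Ext) :
    g * h = ⟨g.central + h.central + D.εσ g.bar h.bar, g.bar + h.bar⟩ := rfl

theorem Ext.one_def : (1 : D.Ext) = ⟨0, 0⟩ := rfl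

theorem Ext.inv_def (g : D.Ext) :
    g⁻¹ = ⟨-g.central - D.εσ (-g.bar) g.bar, -g.bar⟩ := rfl

instance : Group D.Ext :=
  Group.ofLeftAxioms
    (fun a b c => by
      simp only [Ext.mul_def, Ext.mk.injEq]
      refine ⟨?_, add_assoc _ _ _⟩
      linear_combination D.εσ_cocycle a.bar b.bar c.bar)
    (fun a => by
      simp only [Ext.mul_def, Ext.one_def, D.εσ_zero_left, zero_add, add_zero])
    (fun a => by
      simp only [Ext.mul_def, Ext.one_def, Ext.inv_def, Ext.mk.injEq]
      exact ⟨by ring, neg_add_cancel _⟩)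

/-- The subgroup `Q̂_σ` of `L̂_σ` lying over a sublattice `Q`. -/
def hat (Q : Submodule ℤ L) : Subgroup D.Ext where
  carrier := {g | g.bar ∈ Q}
  mul_mem' ha hb := Q.add_mem ha hb
  one_mem' := Q.zero_mem
  inv_mem' ha := Q.neg_mem ha

/-- The sublattice `N = {α ∈ L | ⟨α, 𝔥₍₀₎⟩ = 0}`. -/
def N : Submodule ℤ L where
  carrier := {α | ∀ h ∈ D.eig 0, D.formC (1 ⊗ₜ α) h = 0}
  add_mem' := by
    intro a b ha hb h hh
    rw [TensorProduct.tmul_add, map_add, LinearMap.add_apply, ha h hh, hb h hh, add_zero]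
  zero_mem' := by intro h _; simp
  smul_mem' := by
    intro c a ha h hh
    rw [TensorProduct.tmul_smul, map_zsmul, LinearMap.smul_apply, ha h hh, smul_zero]

/-- The sublattice `M = (1 - σ) L`. -/
def M : Submodule ℤ L := LinearMap.range (LinearMap.id - (D.σ : L →ₗ[ℤ] L))

end Extension

end LatticeDatum

section TwistedSpace

variable {T : Type*} [AddCommGroup T] [Module ℂ T]

namespace LatticeDatum

variable {L : Type*} [AddCommGroup L] (D : LatticeDatum L)

/-- The conditions on the `N̂_σ`-module `T`: it is irreducible, the central generator `κ` acts as
the scalar `ξ`, and `M̂_σ` acts through a homomorphism `τ : M̂_σ → ⟨ξ⟩`. -/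
structure IsInducing (ρ : Representation ℂ (D.hat D.N) T) : Prop where
  irreducible : ρ.IsIrreducible
  kappa : ∀ t, ρ ⟨⟨1, 0⟩, D.N.zero_mem⟩ t = D.ξ • t
  character : ∃ τ : D.hat D.M →* ℂˣ, (∀ g, ∃ m : ℤ, (τ g : ℂ) = D.ξ ^ m) ∧
    ∀ (g : D.hat D.M) (hg : (g : D.Ext) ∈ D.hat D.N) (t : T), ρ ⟨g, hg⟩ t = (τ g : ℂ) • t

variable (ρ : Representation ℂ (D.hat D.N) T)

/-- The induced module `U_T = Ind T` from `N̂_σ` to `L̂_σ`. In Mathlib's model, `IndV.mk g t` is the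
vector `g⁻¹ · (1 ⊗ t)`. -/
abbrev UT : Type _ := Representation.IndV (D.hat D.N).subtype ρ

/-- The vector `g⁻¹ · (1 ⊗ t)` of `U_T`, which lies over the class of `-ḡ` in `L / N`. -/
abbrev UT.mk (g : D.Ext) : T →ₗ[ℂ] D.UT ρ := Representation.IndV.mk (D.hat D.N).subtype ρ g

/-- The action of `L̂_σ` on `U_T`. -/
def groupAct : Representation ℂ D.Ext (D.UT ρ) := Representation.ind (D.hat D.N).subtype ρ

/-- Linear maps out of `U_T`, given on the vectors `UT.mk g t`. -/
def UT.lift {X : Type*} [AddCommGroup X] [Module ℂ X] (φ : D.Ext → T →ₗ[ℂ] X)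
    (hφ : ∀ (n : D.hat D.N) g t, φ (n * g) (ρ n t) = φ g t) : D.UT ρ →ₗ[ℂ] X :=
  Representation.Coinvariants.lift _
    (TensorProduct.lift ((Finsupp.lift (T →ₗ[ℂ] X) ℂ D.Ext φ) ∘ₗ
      (MonoidAlgebra.coeffLinearEquiv ℂ).toLinearMap)) <| by
    intro n
    refine TensorProduct.ext (MonoidAlgebra.lhom_ext' fun g => LinearMap.ext_ring ?_)
    ext t
    simpa using hφ n g t

theorem UT.lift_mk {X : Type*} [AddCommGroup X] [Module ℂ X] (φ : D.Ext → T →ₗ[ℂ] X)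
    (hφ : ∀ (n : D.hat D.N) g t, φ (n * g) (ρ n t) = φ g t) (g : D.Ext) (t : T) :
    UT.lift D ρ φ hφ (UT.mk D ρ g t) = φ g t := by
  simp [UT.lift, UT.mk]

theorem UT.mk_mul (n : D.hat D.N) (g : D.Ext) (t : T) :
    UT.mk D ρ (n * g) (ρ n t) = UT.mk D ρ g t := by
  have := Representation.Coinvariants.mk_self_apply
    (Representation.tprod ((Representation.leftRegular ℂ D.Ext).comp (D.hat D.N).subtype) ρ) n
    (MonoidAlgebra.single g 1 ⊗ₜ t)
  simpa [UT.mk] using this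

/-- The integer `∑ᵣ ⟨σʳ α, β⟩ = p ⟨α₍₀₎, β₍₀₎⟩`. -/
def orbitPairing (α β : L) : ℤ := ∑ r ∈ Finset.range D.p, D.pairing r α β

theorem formC_tmul (α β : L) : D.formC (1 ⊗ₜ α) (1 ⊗ₜ β) = (D.form α β : ℂ) := by
  simp [formC]

theorem orbitPairing_eq_zero (α β : L) (hβ : β ∈ D.N) : D.orbitPairing α β = 0 := by
  have hmem : (∑ r ∈ Finset.range D.p, (1 : ℂ) ⊗ₜ[ℤ] ((D.σ ^ r) α)) ∈ D.eig 0 := by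
    rw [eig, Module.End.mem_eigenspace_iff, zpow_zero, one_smul, map_sum]
    have e : ∀ r : ℕ, D.σC ((1 : ℂ) ⊗ₜ[ℤ] ((D.σ ^ r) α)) = (1 : ℂ) ⊗ₜ[ℤ] ((D.σ ^ (r + 1)) α) := by
      intro r
      rw [pow_succ']
      simp [σC]
    simp only [e]
    have h1 := Finset.sum_range_succ (fun r : ℕ => (1 : ℂ) ⊗ₜ[ℤ] ((D.σ ^ r) α)) D.p
    rw [Finset.sum_range_succ', D.σ_pow_p] at h1
    simpa using h1
  have h := hβ _ hmem
  rw [map_sum] at h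
  simp only [formC_tmul] at h
  have h2 : ((D.orbitPairing α β : ℤ) : ℂ) = 0 := by
    rw [← h, orbitPairing]
    push_cast
    exact Finset.sum_congr rfl fun r _ => by rw [pairing, D.form_symm]
  exact_mod_cast h2

/-- The operator `h₍₀₎(0)` on `U_T`, acting on `g · t` as the scalar `⟨h₍₀₎, ḡ₍₀₎⟩ = ⟨h₍₀₎, ḡ⟩`. -/
def zeroMode (h : Cartan L) : Module.End ℂ (D.UT ρ) :=
  UT.lift D ρ (fun g => D.formC (D.proj 0 h) (1 ⊗ₜ (-g.bar)) • UT.mk D ρ g) <| by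
    intro n g t
    have hn : D.formC (D.proj 0 h) (1 ⊗ₜ (n : D.Ext).bar) = 0 := by
      have h1 := n.2 (D.proj 0 h) (D.proj 0 h).2
      rw [← h1]
      exact (LinearMap.BilinForm.IsSymm.baseChange ℂ ⟨D.form_symm⟩).eq _ _
    have h2 : ((n : D.Ext) * g).bar = (n : D.Ext).bar + g.bar := rfl
    rw [LinearMap.smul_apply, LinearMap.smul_apply, UT.mk_mul, h2, neg_add,
      TensorProduct.tmul_add, map_add, TensorProduct.tmul_neg, map_neg, hn, neg_zero, zero_add]

/-- The operator `z ^ α₍₀₎ : U_T → U_T[x, x⁻¹]`, `x = z ^ (1/p)`, which sends `g · t` to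
`x ^ (p ⟨α₍₀₎, ḡ₍₀₎⟩) (g · t)`. -/
def zPow (α : L) : D.UT ρ →ₗ[ℂ] (ℤ →₀ D.UT ρ) :=
  UT.lift D ρ (fun g => Finsupp.lsingle (D.orbitPairing α (-g.bar)) ∘ₗ UT.mk D ρ g) <| by
    intro n g t
    have h2 : -((n : D.Ext) * g).bar = -(n : D.Ext).bar + -g.bar := neg_add _ _
    have h3 : D.orbitPairing α (-((n : D.Ext) * g).bar) = D.orbitPairing α (-g.bar) := by
      rw [h2]
      have := D.orbitPairing_eq_zero α _ (D.N.neg_mem n.2)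
      have h4 : ∀ a b, D.orbitPairing α (a + b) = D.orbitPairing α a + D.orbitPairing α b := by
        intro a b
        simp [orbitPairing, pairing, Finset.sum_add_distrib]
      rw [h4, this, zero_add]
    change Finsupp.single (D.orbitPairing α (-((n : D.Ext) * g).bar)) (UT.mk D ρ (n * g) (ρ n t)) =
      Finsupp.single (D.orbitPairing α (-g.bar)) (UT.mk D ρ g t)
    rw [UT.mk_mul, h3]

/-- The space `M(1)[σ]`, the module over the twisted affine Lie algebra `𝔥̂[σ]` induced from the
one-dimensional module `ℂ` of `𝔟̂[σ]`. By the Poincaré–Birkhoff–Witt theorem it is the symmetric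
algebra on the creation operators `y(-(m+1)/p)`, `y ∈ 𝔥₍₋₍ₘ₊₁₎₎`, `m ∈ ℕ`, which act by
multiplication; the operators `x(n)` with `n > 0` act as the derivations with
`y(-n) ↦ [x(n), y(-n)] = n ⟨x, y⟩`, and kill the other generators. -/
abbrev TwistedFock : Type _ := Fock fun m : ℕ => D.eig (-(m + 1 : ℤ))

/-- The space `V_L^T = M(1)[σ] ⊗ U_T`. -/
abbrev VLT : Type _ := D.TwistedFock ⊗[ℂ] D.UT ρ

/-- The functional `y ↦ [h₍ₘ₊₁₎((m+1)/p), y(-(m+1)/p)] = ((m+1)/p) ⟨h, y⟩` on `𝔥₍₋₍ₘ₊₁₎₎`. -/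
def twistedBracket (h : Cartan L) (m : ℕ) : D.eig (-(m + 1 : ℤ)) →ₗ[ℂ] ℂ :=
  (((m : ℂ) + 1) / D.p) • (D.formC (D.proj (m + 1) h) ∘ₗ (D.eig (-(m + 1 : ℤ))).subtype)

/-- The action of `h₍ⱼ₎(j/p) ∈ 𝔥̂[σ]` on `V_L^T = M(1)[σ] ⊗ U_T`, for `h ∈ 𝔥` and `j ∈ ℤ`. -/
def mode (h : Cartan L) : ℤ → Module.End ℂ (D.VLT ρ)
  | .ofNat 0 => TensorProduct.map LinearMap.id (D.zeroMode ρ h)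
  | .ofNat (m + 1) => TensorProduct.map (annihilator m (D.twistedBracket h m)).toLinearMap LinearMap.id
  | .negSucc m => TensorProduct.map
      (LinearMap.mulLeft ℂ (creator (H := fun m : ℕ => D.eig (-(m + 1 : ℤ))) m
        (D.proj (-(m + 1 : ℤ)) h))) LinearMap.id

theorem isFil_VLT : IsFil (tensorFil (fockFil fun m : ℕ => D.eig (-(m + 1 : ℤ))) (D.UT ρ)) :=
  isFil_tensor (isFil_fock _) _

theorem lowers_id {X : Type*} [AddCommGroup X] [Module ℂ X] (G : ℤ → Submodule ℂ X) :
    Lowers G 0 LinearMap.id := fun D x hx => by simpa using hx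

theorem lowers_mode (h : Cartan L) (j : ℕ) :
    Lowers (tensorFil (fockFil fun m : ℕ => D.eig (-(m + 1 : ℤ))) (D.UT ρ)) j (D.mode ρ h j) := by
  cases j with
  | zero => exact (lowers_id (fockFil fun m : ℕ => D.eig (-(m + 1 : ℤ)))).tensor (D.zeroMode ρ h)
  | succ m =>
    have h1 : Lowers (fockFil fun m : ℕ => D.eig (-(m + 1 : ℤ))) ((m + 1 : ℕ) : ℤ)
        (annihilator m (D.twistedBracket h m)).toLinearMap := by
      intro D' x hx
      exact_mod_cast annihilator_mem m _ D' x hx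
    exact h1.tensor LinearMap.id

theorem isCurrent_mode (h : Cartan L) : IsCurrent (D.mode ρ h) := by
  intro w
  obtain ⟨B, hB⟩ := (D.isFil_VLT ρ).exhaust w
  refine ⟨max 0 (B + 1), fun j hj => ?_⟩
  obtain ⟨n, rfl⟩ := Int.eq_ofNat_of_zero_le ((le_max_left _ _).trans hj)
  have := (le_max_right _ _).trans hj
  exact (D.isFil_VLT ρ).neg (B - n) (by linarith) _ (D.lowers_mode ρ h n B w hB)

end LatticeDatum

end TwistedSpace

section TwistedVertexOperators

variable {T : Type*} [AddCommGroup T] [Module ℂ T]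

namespace LatticeDatum

variable {L : Type*} [AddCommGroup L] (D : LatticeDatum L)
variable (ρ : Representation ℂ (D.hat D.N) T)

/-- The coefficient of `xʲ`, `x = z ^ (1/p)`, in
`E⁻_σ(-α, z) = exp (∑_{n ∈ -(1/p)ℤ_{>0}} (-α₍ₚₙ₎(n) / n) z ^ (-n))`. -/
def Eminus (α : L) : ℕ → Module.End ℂ (D.VLT ρ) :=
  expCoeff (PowerSeries.mk fun m : ℕ => ((D.p : ℂ) / m) • D.mode ρ (1 ⊗ₜ α) (-m))

/-- The coefficient of `x ^ (-j)`, `x = z ^ (1/p)`, in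
`E⁺_σ(-α, z) = exp (∑_{n ∈ (1/p)ℤ_{>0}} (-α₍ₚₙ₎(n) / n) z ^ (-n))`. -/
def Eplus (α : L) : ℕ → Module.End ℂ (D.VLT ρ) :=
  expCoeff (PowerSeries.mk fun m : ℕ => (-(D.p : ℂ) / m) • D.mode ρ (1 ⊗ₜ α) m)

/-- The coefficients of `E⁺_σ(-α, z) (κ⁰, e_α) z ^ α₍₀₎`: the index `(j, l)` stands for the
coefficient of `x ^ (-j)` in `E⁺_σ(-α, z)` and of `xˡ` in `z ^ α₍₀₎`, where `x = z ^ (1/p)`. -/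
def rightFactor (α : L) (t : ℕ × ℤ) : Module.End ℂ (D.VLT ρ) :=
  D.Eplus ρ α t.1 *
    TensorProduct.map LinearMap.id (D.groupAct ρ ⟨0, α⟩ ∘ₗ Finsupp.lapply t.2 ∘ₗ D.zPow ρ α)

theorem rightFactor_locFin (α : L) : LocFin (D.rightFactor ρ α) := by
  have h1 : ∀ w, {l : ℤ | (TensorProduct.map LinearMap.id
      (D.groupAct ρ ⟨0, α⟩ ∘ₗ Finsupp.lapply l ∘ₗ D.zPow ρ α) : Module.End ℂ (D.VLT ρ)) w ≠
        0}.Finite := by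
    intro w
    induction w using TensorProduct.induction_on with
    | zero => simp
    | tmul s u =>
      refine (D.zPow ρ α u).support.finite_toSet.subset fun l hl => ?_
      by_contra h0
      have : D.zPow ρ α u l = 0 := by simpa using h0
      exact hl (by simp [this])
    | add a b ha hb =>
      refine (ha.union hb).subset fun l hl => ?_
      by_contra h0
      rw [Set.mem_union, not_or] at h0
      have ha0 := not_not.1 h0.1
      have hb0 := not_not.1 h0.2
      exact hl (by rw [map_add, ha0, hb0, add_zero])
  have h2 : LocFin (D.Eplus ρ α) := by
    refine LocFin.of_lowers (D.isFil_VLT ρ) fun j => Lowers.expCoeff (fun m => ?_) j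
    rw [PowerSeries.coeff_mk]
    exact (D.lowers_mode ρ _ m).smul _
  intro w
  refine ((h1 w).biUnion (t := fun l => (fun j : ℕ => (j, l)) ''
    {j | D.Eplus ρ α j ((TensorProduct.map LinearMap.id
      (D.groupAct ρ ⟨0, α⟩ ∘ₗ Finsupp.lapply l ∘ₗ D.zPow ρ α) : Module.End ℂ (D.VLT ρ)) w) ≠
        0}) fun l _ => (h2 _).image _).subset ?_
  rintro ⟨j, l⟩ hjl
  refine Set.mem_biUnion (x := l) ?_ ⟨j, hjl, rfl⟩
  intro h0
  exact hjl (by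
    rw [rightFactor, Module.End.mul_apply]
    exact (congrArg _ h0).trans (map_zero _))

/-- The constant `p ^ (-⟨α, α⟩/2) ∏_{0 < r < p/2} (1 - ζʳ) ^ ⟨σʳ α, α⟩`. -/
def vertexConst (α : L) : ℂ :=
  (D.p : ℂ) ^ (-(D.form α α / 2)) *
    ∏ r ∈ Finset.Icc 1 ((D.p - 1) / 2), (1 - D.ζ ^ r) ^ D.pairing r α α

/-- The twisted vertex operator
`W(e^α, z) = C_α E⁻_σ(-α, z) E⁺_σ(-α, z) (κ⁰, e_α) z ^ (α₍₀₎ + {⟨α₍₀₎, α₍₀₎⟩ - ⟨α, α⟩}/2)`,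
as a series in `x = z ^ (1/p)`. The power of `x` in the last factor is
`(∑ᵣ ⟨σʳ α, α⟩ - p ⟨α, α⟩) / 2`, which is an integer since `p` is odd and `L` is even. -/
def expField (α : L) : FieldSpace (D.VLT ρ) :=
  D.vertexConst α • glueField (D.Eminus ρ α) (D.rightFactor ρ α) (D.rightFactor_locFin ρ α)
    ((D.orbitPairing α α - D.p * D.form α α) / 2)

/-- The modes of the differentiated current `(1/n!) (d/dz)ⁿ ∑ⱼ h₍ⱼ₎(j/p) z ^ (-j/p - 1)
= ∑ⱼ C(-j/p - 1, n) h₍ⱼ₎(j/p) z ^ (-j/p - 1 - n)`. -/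
def currentMode (n : ℕ) (h : Cartan L) (j : ℤ) : Module.End ℂ (D.VLT ρ) :=
  ((Ring.choose (-(j / D.p : ℚ) - 1) n : ℚ) : ℂ) • D.mode ρ h j

theorem isCurrent_currentMode (n : ℕ) (h : Cartan L) : IsCurrent (D.currentMode ρ n h) := by
  intro w
  obtain ⟨J, hJ⟩ := D.isCurrent_mode ρ h w
  exact ⟨J, fun j hj => by simp [currentMode, hJ j hj]⟩

theorem zeroMode_add (h h' : Cartan L) :
    D.zeroMode ρ (h + h') = D.zeroMode ρ h + D.zeroMode ρ h' := by
  refine Representation.IndV.hom_ext _ _ fun g => LinearMap.ext fun t => ?_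
  change D.zeroMode ρ (h + h') (UT.mk D ρ g t) =
    D.zeroMode ρ h (UT.mk D ρ g t) + D.zeroMode ρ h' (UT.mk D ρ g t)
  simp only [zeroMode, UT.lift_mk, LinearMap.smul_apply, map_add, Submodule.coe_add,
    LinearMap.add_apply, add_smul]

theorem zeroMode_smul (c : ℂ) (h : Cartan L) : D.zeroMode ρ (c • h) = c • D.zeroMode ρ h := by
  refine Representation.IndV.hom_ext _ _ fun g => LinearMap.ext fun t => ?_
  change D.zeroMode ρ (c • h) (UT.mk D ρ g t) = c • D.zeroMode ρ h (UT.mk D ρ g t)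
  simp only [zeroMode, UT.lift_mk, LinearMap.smul_apply, map_smul, SetLike.val_smul, smul_smul,
    smul_eq_mul]

theorem zeroMode_comm (h h' : Cartan L) :
    D.zeroMode ρ h * D.zeroMode ρ h' = D.zeroMode ρ h' * D.zeroMode ρ h := by
  refine Representation.IndV.hom_ext _ _ fun g => LinearMap.ext fun t => ?_
  change D.zeroMode ρ h (D.zeroMode ρ h' (UT.mk D ρ g t)) =
    D.zeroMode ρ h' (D.zeroMode ρ h (UT.mk D ρ g t))
  simp only [zeroMode, UT.lift_mk, LinearMap.smul_apply, map_smul, smul_smul, mul_comm]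

theorem twistedBracket_add (h h' : Cartan L) (m : ℕ) :
    D.twistedBracket (h + h') m = D.twistedBracket h m + D.twistedBracket h' m := by
  ext y
  simp [twistedBracket, mul_add]

theorem twistedBracket_smul (c : ℂ) (h : Cartan L) (m : ℕ) :
    D.twistedBracket (c • h) m = c • D.twistedBracket h m := by
  ext y
  simp [twistedBracket]
  ring

theorem mode_add (h h' : Cartan L) (j : ℤ) :
    D.mode ρ (h + h') j = D.mode ρ h j + D.mode ρ h' j := by
  rcases j with (_ | m) | m
  · simp only [mode, zeroMode_add, TensorProduct.map_add_right]
  · simp only [mode]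
    rw [← TensorProduct.map_add_left]
    congr 1
    ext s
    exact (congrArg (fun f => annihilator m f s) (D.twistedBracket_add h h' m)).trans
      (annihilator_add _ _ _ _)
  · simp only [mode]
    rw [← TensorProduct.map_add_left]
    congr 1
    ext s
    simp [add_mul]

theorem mode_smul (c : ℂ) (h : Cartan L) (j : ℤ) : D.mode ρ (c • h) j = c • D.mode ρ h j := by
  rcases j with (_ | m) | m
  · simp only [mode, zeroMode_smul, TensorProduct.map_smul_right]
  · simp only [mode]
    rw [← TensorProduct.map_smul_left]
    congr 1
    ext s
    exact (congrArg (fun f => annihilator m f s) (D.twistedBracket_smul c h m)).trans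
      (annihilator_smul _ _ _ _)
  · simp only [mode]
    rw [← TensorProduct.map_smul_left]
    congr 1
    ext s
    simp

theorem mode_comm_neg (h h' : Cartan L) (i : ℤ) (hi : i < 0) (j : ℤ) (hj : j < 0) :
    D.mode ρ h i * D.mode ρ h' j = D.mode ρ h' j * D.mode ρ h i := by
  obtain ⟨m, rfl⟩ := Int.eq_negSucc_of_lt_zero hi
  obtain ⟨n, rfl⟩ := Int.eq_negSucc_of_lt_zero hj
  refine map_mul_comm (LinearMap.ext fun s => ?_) rfl
  simp only [Module.End.mul_apply, LinearMap.mulLeft_apply]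
  ring

theorem mode_comm_pos (h h' : Cartan L) (i : ℤ) (hi : 0 ≤ i) (j : ℤ) (hj : 0 ≤ j) :
    D.mode ρ h i * D.mode ρ h' j = D.mode ρ h' j * D.mode ρ h i := by
  obtain ⟨m, rfl⟩ := Int.eq_ofNat_of_zero_le hi
  obtain ⟨n, rfl⟩ := Int.eq_ofNat_of_zero_le hj
  rcases m with _ | m <;> rcases n with _ | n
  · exact map_mul_comm rfl (D.zeroMode_comm ρ h h')
  · exact map_mul_comm rfl rfl
  · exact map_mul_comm rfl rfl
  · exact map_mul_comm (LinearMap.ext fun s => contract_comm _ _ s) rfl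

/-- The operator `F(z) ↦ : (1/n!) (d/dz)ⁿ h(z) F(z) :` on fields, where
`h(z) = ∑ⱼ h₍ⱼ₎(j/p) z ^ (-j/p - 1)`. -/
def currentProduct (n : ℕ) : Cartan L →ₗ[ℂ] Module.End ℂ (FieldSpace (D.VLT ρ)) :=
  normalProductLin (D.currentMode ρ n) (D.isCurrent_currentMode ρ n)
    (fun h h' j => by rw [currentMode, mode_add, smul_add]; rfl)
    (fun r h j => by rw [currentMode, mode_smul, smul_comm]; rfl) (D.p * (n + 1))

theorem currentProduct_comm (m n : ℕ) (h h' : Cartan L) :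
    D.currentProduct ρ m h * D.currentProduct ρ n h' =
      D.currentProduct ρ n h' * D.currentProduct ρ m h := by
  refine normalProduct_comm _ _ (D.isCurrent_currentMode ρ m h) (D.isCurrent_currentMode ρ n h')
    _ _ (fun i hi j hj => ?_) (fun i hi j hj => ?_)
  · simp only [currentMode, smul_mul_assoc, mul_smul_comm, D.mode_comm_neg ρ h h' i hi j hj]
    rw [smul_comm]
  · simp only [currentMode, smul_mul_assoc, mul_smul_comm, D.mode_comm_pos ρ h h' i hi j hj]
    rw [smul_comm]

/-- The space `M(1)`, the induced module of the untwisted affine Lie algebra `𝔥̂`: the symmetric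
algebra on the creation operators `h(-(m+1))`, `h ∈ 𝔥`, `m ∈ ℕ`. -/
abbrev UntwistedFock (L : Type*) [AddCommGroup L] : Type _ := Fock fun _ : ℕ => Cartan L

/-- The space `V_L = M(1) ⊗ ℂ{L}`, where `ℂ{L}` has the basis `e^α = Finsupp.single α 1`. -/
abbrev VL (L : Type*) [AddCommGroup L] : Type _ := UntwistedFock L ⊗[ℂ] (L →₀ ℂ)

/-- The iterated normal ordered products `h(-(n+1)) ↦ : (1/n!) (d/dz)ⁿ h(z) · :`. -/
def currentAction : UntwistedFock L →ₐ[ℂ] Module.End ℂ (FieldSpace (D.VLT ρ)) :=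
  fockLift (A := Module.End ℂ (FieldSpace (D.VLT ρ))) (H := fun _ : ℕ => Cartan L)
    (D.currentProduct ρ) (D.currentProduct_comm ρ)

/-- The map `W(·, z)` from `V_L` to fields on `V_L^T`, which sends
`h₁(-n₁) ⋯ hₖ(-nₖ) 1 ⊗ e^α` to the normal ordered product
`: ∏ᵢ (1/(nᵢ-1)!) (d/dz) ^ (nᵢ-1) hᵢ(z) · W(e^α, z) :`. -/
def W : VL L →ₗ[ℂ] FieldSpace (D.VLT ρ) :=
  TensorProduct.lift
    (LinearMap.lcomp ℂ (FieldSpace (D.VLT ρ)) (Finsupp.linearCombination ℂ (D.expField ρ)) ∘ₗ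
      (D.currentAction ρ).toLinearMap)

/-- The operator `h(m)`, `m ≥ 0`, on `V_L = M(1) ⊗ ℂ{L}`: it acts on `e^β` as `⟨h, β⟩` if `m = 0`,
and on `M(1)` by `[h(m), y(-n)] = δ_{m,n} m ⟨h, y⟩` if `m > 0`. -/
def untwistedMode (h : Cartan L) : ℕ → Module.End ℂ (VL L)
  | 0 => TensorProduct.map LinearMap.id
      (Finsupp.linearCombination ℂ fun β : L => Finsupp.single β (D.formC h (1 ⊗ₜ β)))
  | m + 1 => TensorProduct.map
      (annihilator (H := fun _ : ℕ => Cartan L) m (((m : ℂ) + 1) • D.formC h)).toLinearMap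
      LinearMap.id

theorem lowers_untwistedMode (h : Cartan L) (j : ℕ) :
    Lowers (tensorFil (fockFil fun _ : ℕ => Cartan L) (L →₀ ℂ)) j (D.untwistedMode h j) := by
  cases j with
  | zero => exact (lowers_id (fockFil fun _ : ℕ => Cartan L)).tensor _
  | succ m =>
    have h1 : Lowers (fockFil fun _ : ℕ => Cartan L) ((m + 1 : ℕ) : ℤ)
        (annihilator (H := fun _ : ℕ => Cartan L) m (((m : ℂ) + 1) • D.formC h)).toLinearMap := by
      intro D' x hx
      exact_mod_cast annihilator_mem m _ D' x hx
    exact h1.tensor LinearMap.id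

/-- The power series `((1 + x) ^ (1/p) - ζ ^ (-r) (1 + y) ^ (1/p)) / (1 - ζ ^ (-r)) - 1` in two
variables, as a power series in `x` with coefficients in `ℂ⟦y⟧`. -/
def logArgument (r : ℕ) : PowerSeries (PowerSeries ℂ) :=
  PowerSeries.C (PowerSeries.C (1 - D.ζ⁻¹ ^ r)⁻¹) *
    (PowerSeries.map PowerSeries.C (PowerSeries.binomialSeries ℂ (1 / D.p : ℚ)) -
      PowerSeries.C (PowerSeries.C (D.ζ⁻¹ ^ r) * PowerSeries.binomialSeries ℂ (1 / D.p : ℚ))) - 1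

/-- The coefficient of `xᵐ yⁿ` in
`log (((1 + x) ^ (1/p) - ζ ^ (-r) (1 + y) ^ (1/p)) / (1 - ζ ^ (-r)))`, for `0 < r < p`, through
the expansion `log (1 + u) = ∑_{q ≥ 1} (-1) ^ (q + 1) u ^ q / q` (summands with `q > m + n` do not
contribute). -/
def logCoeff (r m n : ℕ) : ℂ :=
  ∑ q ∈ Finset.Icc 1 (m + n), ((-1) ^ (q + 1) / (q : ℂ)) *
    PowerSeries.coeff n (PowerSeries.coeff m (D.logArgument r ^ q))

/-- The constants `c_{mnr}`, `0 ≤ r < p`. -/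
def deltaConst (m n r : ℕ) : ℂ :=
  if r = 0 then -(1 / 2) * ∑ q ∈ Finset.Icc 1 (D.p - 1), D.logCoeff q m n
  else (1 / 2) * D.logCoeff r m n

variable [Module.Free ℤ L] [Module.Finite ℤ L]

/-- The Gram matrix of the form with respect to a `ℤ`-basis of `L`. -/
def gram : Matrix (Fin (Module.finrank ℤ L)) (Fin (Module.finrank ℤ L)) ℂ :=
  Matrix.of fun i j => (D.form (Module.finBasis ℤ L i) (Module.finBasis ℤ L j) : ℂ)

/-- The coefficient of `z ^ (-k)` in
`Δ_z = ∑_{m,n ≥ 0} ∑_{r < p} ∑ᵢ c_{mnr} (σ ^ (-r) βᵢ)(m) βᵢ(n) z ^ (-m-n)`, where `(βᵢ)` is an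
orthonormal basis of `𝔥`. The canonical element `∑ᵢ βᵢ ⊗ βᵢ` is written as
`∑ᵢⱼ (G⁻¹)ᵢⱼ bᵢ ⊗ bⱼ` for the `ℤ`-basis `(bᵢ)` of `L` with Gram matrix `G`. -/
def deltaOp (k : ℕ) : Module.End ℂ (VL L) :=
  ∑ mn ∈ Finset.HasAntidiagonal.antidiagonal k, ∑ r ∈ Finset.range D.p, ∑ i, ∑ j,
    (D.deltaConst mn.1 mn.2 r * D.gram⁻¹ i j) •
      (D.untwistedMode (1 ⊗ₜ ((D.σ⁻¹ ^ r) (Module.finBasis ℤ L i))) mn.1 *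
        D.untwistedMode (1 ⊗ₜ (Module.finBasis ℤ L j)) mn.2)

/-- The coefficient of `z ^ (-k)` in `exp Δ_z`. (`Δ_z` has no constant term as `c_{00r} = 0`.) -/
def expDelta : ℕ → Module.End ℂ (VL L) := expCoeff (PowerSeries.mk D.deltaOp)

theorem expDelta_locFin : LocFin D.expDelta := by
  refine LocFin.of_lowers (isFil_tensor (isFil_fock fun _ : ℕ => Cartan L) (L →₀ ℂ))
    fun j => Lowers.expCoeff (fun k => ?_) j
  rw [PowerSeries.coeff_mk]
  refine Lowers.sum _ fun mn hmn => Lowers.sum _ fun r _ => Lowers.sum _ fun i _ =>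
    Lowers.sum _ fun j _ => Lowers.smul _ ?_
  have : (k : ℤ) = (mn.1 : ℤ) + mn.2 := by
    rw [← Finset.HasAntidiagonal.mem_antidiagonal.1 hmn]; push_cast; ring
  rw [this]
  exact (D.lowers_untwistedMode _ _).mul (D.lowers_untwistedMode _ _)

/-- The `σ`-twisted vertex operators `Y_σ(v, z) = W(e^{Δ_z} v, z)`, `v ∈ V_L`, on `V_L^T`, as series
in `x = z ^ (1/p)`: the operator `vₙ`, `n ∈ (1/p)ℤ`, that is, the coefficient of `z ^ (-n-1)`, is
the coefficient of `x ^ (-p(n+1))`. -/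
def Yσ : VL L →ₗ[ℂ] FieldSpace (D.VLT ρ) :=
  locSum (fun j : ℕ => (fieldShift ((D.p : ℤ) * j) ∘ₗ D.W ρ) ∘ₗ D.expDelta j)
    (D.expDelta_locFin.comp _)

/-- A `σ`-twisted `V_L`-submodule of `V_L^T`: a subspace stable under all operators `vₙ`,
`v ∈ V_L`, `n ∈ (1/p)ℤ`. -/
def IsTwistedSubmodule (S : Submodule ℂ (D.VLT ρ)) : Prop :=
  ∀ (v : VL L) (k : ℤ), ∀ w ∈ S, (D.Yσ ρ v).1 k w ∈ S

/-- Irreducibility of `V_L^T` as a `σ`-twisted `V_L`-module: it is nonzero, and has no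
`σ`-twisted submodules other than zero and itself. -/
def IsIrreducibleTwisted : Prop :=
  Nontrivial (D.VLT ρ) ∧
    ∀ S : Submodule ℂ (D.VLT ρ), D.IsTwistedSubmodule ρ S → S = ⊥ ∨ S = ⊤

end LatticeDatum

end TwistedVertexOperators

end TwistedLattice

end

open TwistedLattice

/-!
# Irreducibility of `V_L^T`

The vectors `h(-1)1` and `1 ⊗ e^α` of `V_L` are killed by `Δ_z`: each of its terms either contains
more annihilation operators than these vectors can absorb, or a zero mode acting on `e⁰`, or has
the coefficient `c₀₀ᵣ = 0`.
Hence `Y_σ(h(-1)1, z)` is the twisted current `h(z)` and `Y_σ(e^α, z) = W(e^α, z)`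
(`Yσ_creator`, `Yσ_one_tmul_single`), and a twisted submodule `S` is stable under the twisted
Heisenberg algebra and under all coefficients of the fields `W(e^α, z)`.

The form of `L` is nondegenerate over `ℂ` and pairs `𝔥₍ₙ₎` with `𝔥₍₋ₙ₎`. So the only elements of
the Fock space `M(1)[σ]` killed by all annihilation operators are the constants (characteristic
zero), and a nonzero element of `S` of least depth is a vacuum vector `1 ⊗ u`
(`exists_vacuum_mem`). Conversely `S` is everything as soon as it contains `1 ⊗ U_T`
(`eq_top_of_vacuum_le`). It remains to study the space of `u ∈ U_T` with `1 ⊗ u ∈ S`.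

On `1 ⊗ u`, the factor `E⁺_σ` of `W(e^α, z)` is trivial, and the coefficients of `E⁻_σ`, a series
with constant term `1`, are polynomials in the creation operators; so this space is stable under
the action of `e_α` (`groupAct_mem_of_expField_mem`). It is also stable under the zero modes, whose
weights on `U_T` separate the cosets of `N` in `L`. Therefore it contains a nonzero vector over a
single coset, hence, after a translation by some `e_α`, a nonzero vector of `T`. As `κ` acts as a
scalar and `T` is irreducible over `N̂_σ`, it contains `T`, which generates `U_T`
(`eq_top_of_groupAct_mem`).
-/

noncomputable section
namespace TwistedLattice

/-! ### Joint kernels of derivations -/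

section SymmetricAlgebraInvariants

variable {E : Type*} [AddCommGroup E] [Module ℂ E] {I : Type*}

theorem equivMvPolynomial_contract (b : Module.Basis I ℂ E) (i : I) (s : SymmetricAlgebra ℂ E) :
    SymmetricAlgebra.equivMvPolynomial b (contract (b.coord i) s) =
      MvPolynomial.pderiv i (SymmetricAlgebra.equivMvPolynomial b s) := by
  classical
  induction s using SymmetricAlgebra.induction with
  | algebraMap r => simp [AlgEquiv.commutes, MvPolynomial.algebraMap_eq]
  | ι x =>
    rw [contract_ι, AlgEquiv.commutes]
    have : (Algebra.linearMap ℂ (MvPolynomial I ℂ)) ∘ₗ b.coord i =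
        (MvPolynomial.pderiv i).toLinearMap ∘ₗ
          (SymmetricAlgebra.equivMvPolynomial b).toLinearMap ∘ₗ SymmetricAlgebra.ι ℂ E := by
      refine b.ext fun j => ?_
      simp [Finsupp.single_apply, MvPolynomial.pderiv_X, Pi.single_apply]
    exact congrArg (fun f => f x) this
  | mul a c ha hc => simp [ha, hc]
  | add a c ha hc => simp only [map_add, ha, hc]

/-- In characteristic zero, an element of a symmetric algebra all of whose partial derivatives
vanish is a constant. -/
theorem exists_smul_one_of_contract_eq_zero (b : Module.Basis I ℂ E) (s : SymmetricAlgebra ℂ E)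
    (h : ∀ i, contract (b.coord i) s = 0) : ∃ c : ℂ, s = c • 1 := by
  set P := SymmetricAlgebra.equivMvPolynomial b s with hP
  have hd : ∀ i, MvPolynomial.pderiv i P = 0 := fun i => by
    rw [hP, ← equivMvPolynomial_contract, h, map_zero]
  have hC : P = MvPolynomial.C (MvPolynomial.coeff 0 P) := by
    classical
    ext m
    rw [MvPolynomial.coeff_C]
    split_ifs with hm
    · rw [hm]
    · obtain ⟨i, hi⟩ : ∃ i, m i ≠ 0 := by
        by_contra! hall
        exact hm (Finsupp.ext fun i => (hall i).symm)
      have hm' : m - Finsupp.single i 1 + Finsupp.single i 1 = m :=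
        tsub_add_cancel_of_le (by simpa using Nat.one_le_iff_ne_zero.2 hi)
      have h1 := MvPolynomial.coeff_pderiv (i := i) P (m - Finsupp.single i 1)
      rw [hd, hm', MvPolynomial.coeff_zero] at h1
      refine (mul_eq_zero.1 h1.symm).resolve_right ?_
      exact Nat.cast_add_one_ne_zero _
  refine ⟨MvPolynomial.coeff 0 P, (SymmetricAlgebra.equivMvPolynomial b).injective ?_⟩
  rw [← hP, map_smul, map_one, ← Algebra.algebraMap_eq_smul_one, MvPolynomial.algebraMap_eq]
  exact hC

/-- If the joint kernel of the derivations `d j` of `A` consists of the constants, then the joint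
kernel of the operators `d j ⊗ 1` on `A ⊗ U` is `1 ⊗ U`. -/
theorem exists_one_tmul_of_derivation_eq_zero {A U J : Type*} [CommRing A] [Algebra ℂ A]
    [AddCommGroup U] [Module ℂ U] (d : J → Derivation ℂ A A)
    (hd : ∀ x, (∀ j, d j x = 0) → ∃ c : ℂ, x = c • 1) (w : A ⊗[ℂ] U)
    (hw : ∀ j, TensorProduct.map (d j).toLinearMap LinearMap.id w = 0) :
    ∃ u : U, w = 1 ⊗ₜ u := by
  let 𝓒 := Module.Basis.ofVectorSpace ℂ U
  obtain ⟨x, hx⟩ := TensorProduct.eq_repr_basis_right 𝓒 w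
  have hker : ∀ k j, d j (x k) = 0 := by
    intro k j
    have h1 := hw j
    rw [← hx, Finsupp.sum, map_sum] at h1
    have h2 : ((x.mapRange (d j) (map_zero _)).sum fun k y => y ⊗ₜ[ℂ] 𝓒 k) = 0 := by
      rw [Finsupp.sum_mapRange_index (by simp), ← h1]
      rfl
    have h3 := TensorProduct.sum_tmul_basis_right_eq_zero 𝓒 _ h2
    simpa using DFunLike.congr_fun h3 k
  choose c hc using fun k => hd (x k) (hker k)
  refine ⟨∑ k ∈ x.support, c k • 𝓒 k, ?_⟩
  rw [← hx, Finsupp.sum, TensorProduct.tmul_sum]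
  refine Finset.sum_congr rfl fun k _ => ?_
  rw [TensorProduct.tmul_smul, TensorProduct.smul_tmul', ← hc]

end SymmetricAlgebraInvariants

/-! ### Operators lowering a filtration -/

section Lowering

/-- A nonzero subspace which is stable under operators that strictly lower a filtration contains a
nonzero vector killed by all of them. -/
theorem exists_mem_of_lowers {X J : Type*} [AddCommGroup X] [Module ℂ X] {G : ℤ → Submodule ℂ X}
    (hG : IsFil G) (f : J → Module.End ℂ X) (k : J → ℤ) (hk : ∀ j, 0 < k j)
    (hf : ∀ j, Lowers G (k j) (f j)) (S : Submodule ℂ X) (hS : ∀ j, ∀ x ∈ S, f j x ∈ S)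
    (h0 : S ≠ ⊥) : ∃ x ∈ S, x ≠ 0 ∧ ∀ j, f j x = 0 := by
  obtain ⟨x, hx, hx0⟩ := S.exists_mem_ne_zero_of_ne_bot h0
  obtain ⟨B, ⟨x, hx, hx0, hxB⟩, hmin⟩ := Int.exists_least_of_bdd
    (P := fun B => ∃ x ∈ S, x ≠ 0 ∧ x ∈ G B)
    ⟨0, fun B ⟨x, _, hx0, hxB⟩ => by
      by_contra hB
      exact hx0 (hG.neg B (not_le.1 hB) x hxB)⟩
    ((hG.exhaust x).imp fun B hB => ⟨x, hx, hx0, hB⟩)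
  refine ⟨x, hx, hx0, fun j => ?_⟩
  by_contra hne
  have := hmin _ ⟨_, hS j x hx, hne, hf j B x hxB⟩
  linarith [hk j]

end Lowering

/-! ### Weight components -/

section Weights

/-- A subspace stable under a family of operators `f h` contains the components of its elements
with respect to pairwise distinct systems of eigenvalues `χ i`. -/
theorem mem_of_sum_mem_of_weights {X A I : Type*} [AddCommGroup X] [Module ℂ X]
    (f : A → Module.End ℂ X) (S : Submodule ℂ X) (hS : ∀ h, ∀ x ∈ S, f h x ∈ S)
    (χ : I → A → ℂ) (hχ : Function.Injective χ) (s : Finset I) :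
    ∀ v : I → X, (∀ i ∈ s, ∀ h, f h (v i) = χ i h • v i) → ∑ i ∈ s, v i ∈ S →
      ∀ i ∈ s, v i ∈ S := by
  classical
  induction s using Finset.induction_on with
  | empty => simp
  | insert i₀ s hi₀ ih =>
    intro v hv hsum
    -- Applying `f h - χ i₀ h` removes the component `i₀`.
    have hs : ∀ i ∈ s, v i ∈ S := by
      intro i hi
      obtain ⟨h, hh⟩ : ∃ h, χ i h ≠ χ i₀ h := by
        by_contra! hall
        exact hi₀ (hχ (funext hall) ▸ hi)
      have h1 := S.sub_mem (hS h _ hsum) (S.smul_mem (χ i₀ h) hsum)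
      have h2 : f h (∑ i ∈ insert i₀ s, v i) - χ i₀ h • ∑ i ∈ insert i₀ s, v i =
          ∑ i ∈ s, (χ i h - χ i₀ h) • v i := by
        rw [map_sum, Finset.smul_sum, ← Finset.sum_sub_distrib, Finset.sum_insert hi₀,
          hv i₀ (Finset.mem_insert_self _ _), sub_self, zero_add]
        exact Finset.sum_congr rfl fun j hj => by
          rw [hv j (Finset.mem_insert_of_mem hj), sub_smul]
      rw [h2] at h1
      have h3 := ih (fun j => (χ j h - χ i₀ h) • v j) (fun j hj h' => by
        rw [map_smul, hv j (Finset.mem_insert_of_mem hj), smul_comm]) h1 i hi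
      exact (S.smul_mem_iff (sub_ne_zero.2 hh)).1 h3
    intro i hi
    rcases Finset.mem_insert.1 hi with rfl | hi
    · rw [Finset.sum_insert hi₀] at hsum
      exact (S.add_mem_iff_left (S.sum_mem hs)).1 hsum
    · exact hs i hi

end Weights

/-! ### Normal ordered products and exponentials -/

section Exponential

theorem locSum_comp_apply_of_fixed {X Y : Type*} [AddCommGroup X] [Module ℂ X] [AddCommGroup Y]
    [Module ℂ Y] (g : ℕ → X →ₗ[ℂ] Y) (f : ℕ → Module.End ℂ X)
    (hf : LocFin fun j => g j ∘ₗ f j) (x : X) (h : ∀ j, f j x = if j = 0 then x else 0) :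
    locSum (fun j => g j ∘ₗ f j) hf x = g 0 x := by
  rw [locSum_apply, finsum_eq_single _ 0 fun j hj => by simp [h, hj]]
  simp [h]

/-- The normal ordered product of a current with the identity field is the current. -/
theorem normalProduct_one_field {X : Type*} [AddCommGroup X] [Module ℂ X]
    (a : ℤ → Module.End ℂ X) (ha : IsCurrent a) (c : ℤ) (F : FieldSpace X)
    (hF : ∀ k, F.1 k = if k = 0 then 1 else 0) (k : ℤ) :
    (normalProduct a ha c F).1 k = a (-k - c) := by
  refine LinearMap.ext fun w => ?_
  rw [normalProduct_apply, finsum_eq_single _ (-k - c)]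
  · have h0 : k + (-k - c) + c = 0 := by ring
    simp [normalTerm, hF, h0]
  · intro j hj
    have h3 : k + j + c ≠ 0 := fun h0 => hj (by linarith)
    simp [normalTerm, hF, h3]

variable {X : Type*} [AddCommGroup X] [Module ℂ X]

theorem expCoeff_apply_of_coeff_apply_eq_zero (f : PowerSeries (Module.End ℂ X)) (v : X)
    (h : ∀ j, PowerSeries.coeff j f v = 0) (k : ℕ) :
    expCoeff f k v = if k = 0 then v else 0 := by
  rw [expCoeff, LinearMap.sum_apply, Finset.sum_range_succ', Finset.sum_eq_zero]
  · by_cases hk : k = 0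
    · subst hk; simp
    · simp [PowerSeries.coeff_one, hk]
  · intro q _
    rw [LinearMap.smul_apply, pow_succ, PowerSeries.coeff_mul, LinearMap.sum_apply,
      Finset.sum_eq_zero, smul_zero]
    intro ij _
    rw [Module.End.mul_apply, h, map_zero]

theorem expCoeff_zero_index (f : PowerSeries (Module.End ℂ X)) : expCoeff f 0 = 1 := by
  simp [expCoeff]

theorem expCoeff_apply_mem (f : PowerSeries (Module.End ℂ X)) (S : Submodule ℂ X)
    (h : ∀ j, ∀ x ∈ S, PowerSeries.coeff j f x ∈ S) (k : ℕ) (x : X) (hx : x ∈ S) :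
    expCoeff f k x ∈ S := by
  have hp : ∀ q k : ℕ, ∀ x ∈ S, PowerSeries.coeff k (f ^ q) x ∈ S := by
    intro q
    induction q with
    | zero =>
      intro k x hx
      rw [pow_zero, PowerSeries.coeff_one]
      split_ifs
      · exact hx
      · exact S.zero_mem
    | succ q ih =>
      intro k x hx
      rw [pow_succ, PowerSeries.coeff_mul, LinearMap.sum_apply]
      exact S.sum_mem fun ij _ => ih _ _ (h _ _ hx)
  rw [expCoeff, LinearMap.sum_apply]
  exact S.sum_mem fun q _ => S.smul_mem _ (hp q k x hx)

theorem fockLift_creator {H : ℕ → Type*} [∀ m, AddCommGroup (H m)] [∀ m, Module ℂ (H m)]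
    {A : Type*} [Ring A] [Algebra ℂ A] (f : ∀ m, H m →ₗ[ℂ] A)
    (hf : ∀ m n x y, f m x * f n y = f n y * f m x) (m : ℕ) (x : H m) :
    fockLift f hf (creator m x) = f m x := by
  have h1 : fockLift f hf (creator m x) =
      TensorAlgebra.lift ℂ (DirectSum.toModule ℂ ℕ A f)
        (TensorAlgebra.ι ℂ (DirectSum.lof ℂ ℕ H m x)) := rfl
  rw [h1, TensorAlgebra.lift_ι_apply, DirectSum.toModule_lof]

theorem annihilator_creator {H : ℕ → Type*} [∀ m, AddCommGroup (H m)] [∀ m, Module ℂ (H m)]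
    (m n : ℕ) (φ : H m →ₗ[ℂ] ℂ) (x : H n) : ∃ c : ℂ, annihilator m φ (creator n x) = c • 1 :=
  ⟨_, (contract_ι _ _).trans (Algebra.algebraMap_eq_smul_one _)⟩

end Exponential

namespace LatticeDatum

/-! ### The operator `Δ_z` on generating vectors -/

section DeltaOperator

variable {L : Type*} [AddCommGroup L] (D : LatticeDatum L)

theorem deltaConst_zero_zero (r : ℕ) : D.deltaConst 0 0 r = 0 := by
  simp [deltaConst, logCoeff]

theorem untwistedMode_zero_tmul_single (h : Cartan L) (s : UntwistedFock L) (α : L) :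
    D.untwistedMode h 0 (s ⊗ₜ Finsupp.single α 1) =
      D.formC h (1 ⊗ₜ α) • (s ⊗ₜ Finsupp.single α 1) := by
  refine (TensorProduct.map_tmul _ _ _ _).trans ?_
  rw [Finsupp.linearCombination_single, one_smul, ← Finsupp.smul_single_one,
    TensorProduct.tmul_smul]
  rfl

theorem untwistedMode_succ_one_tmul (h : Cartan L) (m : ℕ) (c : L →₀ ℂ) :
    D.untwistedMode h (m + 1) (1 ⊗ₜ c) = 0 := by
  simp [untwistedMode]

theorem untwistedMode_succ_creator_tmul (h h' : Cartan L) (m : ℕ) (c : L →₀ ℂ) :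
    ∃ b : ℂ, D.untwistedMode h (m + 1) (creator (H := fun _ : ℕ => Cartan L) 0 h' ⊗ₜ c) =
      b • (1 ⊗ₜ c) := by
  obtain ⟨b, hb⟩ := annihilator_creator (H := fun _ : ℕ => Cartan L) m 0
    (((m : ℂ) + 1) • D.formC h) h'
  refine ⟨b, ?_⟩
  rw [TensorProduct.smul_tmul', ← hb]
  rfl

variable [Module.Free ℤ L] [Module.Finite ℤ L]

theorem deltaOp_one_tmul_single (k : ℕ) (α : L) :
    D.deltaOp k (1 ⊗ₜ Finsupp.single α 1) = 0 := by
  simp only [deltaOp, LinearMap.sum_apply, LinearMap.smul_apply, Module.End.mul_apply]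
  refine Finset.sum_eq_zero fun mn _ => Finset.sum_eq_zero fun r _ => Finset.sum_eq_zero fun i _ =>
    Finset.sum_eq_zero fun j _ => ?_
  obtain ⟨m, n⟩ := mn
  rcases n with _ | n
  · rcases m with _ | m
    · simp [deltaConst_zero_zero]
    · simp [untwistedMode_zero_tmul_single, untwistedMode_succ_one_tmul]
  · simp [untwistedMode_succ_one_tmul]

theorem deltaOp_creator_tmul_single_zero (k : ℕ) (h : Cartan L) :
    D.deltaOp k (creator (H := fun _ : ℕ => Cartan L) 0 h ⊗ₜ Finsupp.single 0 1) = 0 := by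
  simp only [deltaOp, LinearMap.sum_apply, LinearMap.smul_apply, Module.End.mul_apply]
  refine Finset.sum_eq_zero fun mn _ => Finset.sum_eq_zero fun r _ => Finset.sum_eq_zero fun i _ =>
    Finset.sum_eq_zero fun j _ => ?_
  obtain ⟨m, n⟩ := mn
  rcases n with _ | n
  · simp [untwistedMode_zero_tmul_single]
  · obtain ⟨b, hb⟩ := D.untwistedMode_succ_creator_tmul
      (1 ⊗ₜ (Module.finBasis ℤ L j)) h n (Finsupp.single 0 1)
    simp only [hb, map_smul]
    rcases m with _ | m
    · simp [untwistedMode_zero_tmul_single]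
    · simp [untwistedMode_succ_one_tmul]

end DeltaOperator

/-! ### The fields attached to generating vectors -/

section ExponentialFields

variable {L : Type*} [AddCommGroup L] (D : LatticeDatum L)
variable {T : Type*} [AddCommGroup T] [Module ℂ T] (ρ : Representation ℂ (D.hat D.N) T)

/-- The exponent of `x = z ^ (1/p)` in the scalar part of `W(e^α, z)`. -/
def expShift (α : L) : ℤ := (D.orbitPairing α α - D.p * D.form α α) / 2

/-- If `s` behaves as a vacuum for `E⁺_σ(-α, z)`, then `W(e^α, z)` acts on `s ⊗ u` through the
creation part, the group element `e_α` and the powers of `z` alone. -/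
theorem expField_tmul (α : L) (s : D.TwistedFock)
    (hs : ∀ j u, D.Eplus ρ α j (s ⊗ₜ u) = if j = 0 then s ⊗ₜ u else 0) (k : ℤ) (u : D.UT ρ) :
    (D.expField ρ α).1 k (s ⊗ₜ u) = D.vertexConst α •
      ∑ l ∈ (D.zPow ρ α u).support, if 0 ≤ k - l - D.expShift α then
        D.Eminus ρ α (k - l - D.expShift α).toNat
          (s ⊗ₜ D.groupAct ρ ⟨0, α⟩ (D.zPow ρ α u l)) else 0 := by
  have hr : ∀ t : ℕ × ℤ, D.rightFactor ρ α t (s ⊗ₜ u) =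
      if t.1 = 0 then s ⊗ₜ D.groupAct ρ ⟨0, α⟩ (D.zPow ρ α u t.2) else 0 := fun t => by
    rw [rightFactor, Module.End.mul_apply, TensorProduct.map_tmul]
    exact hs _ _
  have h1 : (D.expField ρ α).1 k (s ⊗ₜ u) = D.vertexConst α • ∑ᶠ t : ℕ × ℤ,
      (if 0 ≤ k + t.1 - t.2 - D.expShift α then
        D.Eminus ρ α (k + t.1 - t.2 - D.expShift α).toNat * D.rightFactor ρ α t else 0)
        (s ⊗ₜ u) := rfl
  have hinj : Set.InjOn (fun l : ℤ => ((0, l) : ℕ × ℤ)) ((D.zPow ρ α u).support : Set ℤ) :=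
    fun a _ b _ h => (Prod.ext_iff.1 h).2
  rw [h1, finsum_eq_sum_of_support_subset (s := (D.zPow ρ α u).support.image fun l => (0, l)),
    Finset.sum_image hinj]
  · congr 1
    refine Finset.sum_congr rfl fun l _ => ?_
    simp only [Nat.cast_zero, add_zero]
    split_ifs
    · rw [Module.End.mul_apply, hr, if_pos rfl]
    · rfl
  · rintro ⟨j, l⟩ ht
    by_contra hmem
    refine ht ?_
    have h0 : D.rightFactor ρ α (j, l) (s ⊗ₜ u) = 0 := by
      rw [hr]
      split_ifs with hj
      · have hl : D.zPow ρ α u l = 0 := by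
          by_contra hl
          refine hmem ?_
          simp only [Finset.coe_image]
          exact ⟨l, Finsupp.mem_support_iff.2 hl, Prod.ext hj.symm rfl⟩
        simp only [hl, map_zero, TensorProduct.tmul_zero]
      · rfl
    dsimp only
    split_ifs
    · rw [Module.End.mul_apply, h0, map_zero]
    · rfl

theorem zeroMode_mk (h : Cartan L) (g : D.Ext) (t : T) :
    D.zeroMode ρ h (UT.mk D ρ g t) =
      D.formC (D.proj 0 h) (1 ⊗ₜ (-g.bar)) • UT.mk D ρ g t := by
  simp only [zeroMode, UT.lift_mk, LinearMap.smul_apply]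

theorem zPow_mk (α : L) (g : D.Ext) (t : T) :
    D.zPow ρ α (UT.mk D ρ g t) =
      Finsupp.single (D.orbitPairing α (-g.bar)) (UT.mk D ρ g t) := by
  rw [zPow, UT.lift_mk, LinearMap.comp_apply, Finsupp.lsingle_apply]

theorem zPow_zero (u : D.UT ρ) : D.zPow ρ 0 u = Finsupp.single 0 u := by
  have : D.zPow ρ 0 = Finsupp.lsingle 0 := by
    refine Representation.IndV.hom_ext _ _ fun g => LinearMap.ext fun t => ?_
    refine (D.zPow_mk ρ 0 g t).trans ?_
    simp [orbitPairing, pairing]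
  rw [this]
  rfl

theorem mode_zero_left (j : ℤ) : D.mode ρ 0 j = 0 := by
  have := D.mode_smul ρ 0 0 j
  simpa using this

theorem Eplus_zero (j : ℕ) (w : D.VLT ρ) : D.Eplus ρ 0 j w = if j = 0 then w else 0 :=
  expCoeff_apply_of_coeff_apply_eq_zero _ w
    (fun i => by simp [mode_zero_left]) j

theorem Eminus_zero (j : ℕ) (w : D.VLT ρ) : D.Eminus ρ 0 j w = if j = 0 then w else 0 :=
  expCoeff_apply_of_coeff_apply_eq_zero _ w
    (fun i => by simp [mode_zero_left]) j

/-- The vacuum axiom `W(e⁰, z) = 1`. -/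
theorem expField_zero (k : ℤ) : (D.expField ρ 0).1 k = if k = 0 then 1 else 0 := by
  have hd : D.expShift 0 = 0 := by simp [expShift, orbitPairing, pairing]
  have hc : D.vertexConst 0 = 1 := by simp [vertexConst, pairing]
  have hg : D.groupAct ρ ⟨0, 0⟩ = 1 := map_one (D.groupAct ρ)
  refine TensorProduct.ext' fun s u => ?_
  rw [D.expField_tmul ρ 0 s (fun j u => D.Eplus_zero ρ j _), zPow_zero, hd, hc, hg,
    Finset.sum_subset Finsupp.support_single_subset]
  · rw [Finset.sum_singleton, Eminus_zero]
    by_cases hk : k = 0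
    · subst hk; simp
    · by_cases h0 : 0 ≤ k
      · have : ¬ k ≤ 0 := by omega
        simp [hk, this]
      · simp [hk, h0]
  · intro l _ hl
    have : Finsupp.single (0 : ℤ) u l = 0 := Finsupp.notMem_support_iff.1 hl
    simp only [this, map_zero, TensorProduct.tmul_zero, ite_self]

theorem W_tmul_single (s : UntwistedFock L) (α : L) :
    D.W ρ (s ⊗ₜ Finsupp.single α 1) = D.currentAction ρ s (D.expField ρ α) := by
  simp [W]

variable [Module.Free ℤ L] [Module.Finite ℤ L]

theorem Yσ_eq_W (v : VL L) (hv : ∀ k, D.deltaOp k v = 0) : D.Yσ ρ v = D.W ρ v := by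
  have h : ∀ j, D.expDelta j v = if j = 0 then v else 0 := fun j =>
    expCoeff_apply_of_coeff_apply_eq_zero _ v (fun i => by rw [PowerSeries.coeff_mk, hv]) j
  have h1 := locSum_comp_apply_of_fixed (X := VL L) (Y := FieldSpace (D.VLT ρ))
    (fun j : ℕ => fieldShift ((D.p : ℤ) * j) ∘ₗ D.W ρ) D.expDelta (D.expDelta_locFin.comp _) v h
  refine Eq.trans h1 (Subtype.ext (funext fun k => ?_))
  have hk : k + (D.p : ℤ) * (0 : ℕ) = k := by simp
  exact congrArg (D.W ρ v).1 hk

theorem Yσ_one_tmul_single (α : L) :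
    D.Yσ ρ (1 ⊗ₜ Finsupp.single α 1) = D.expField ρ α := by
  rw [Yσ_eq_W _ _ _ fun k => D.deltaOp_one_tmul_single k α, W_tmul_single, map_one]
  rfl

/-- `Y_σ(h(-1)1, z)` is the twisted current `h(z)`. -/
theorem Yσ_creator (h : Cartan L) (k : ℤ) :
    (D.Yσ ρ (creator (H := fun _ : ℕ => Cartan L) 0 h ⊗ₜ Finsupp.single 0 1)).1 k =
      D.mode ρ h (-k - D.p) := by
  rw [Yσ_eq_W _ _ _ fun k => D.deltaOp_creator_tmul_single_zero k h, W_tmul_single]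
  have h1 := fockLift_creator (A := Module.End ℂ (FieldSpace (D.VLT ρ)))
    (H := fun _ : ℕ => Cartan L) (D.currentProduct ρ) (D.currentProduct_comm ρ) 0 h
  have h2 := normalProduct_one_field (X := D.VLT ρ) _ (D.isCurrent_currentMode ρ 0 h)
    (D.p * ((0 : ℕ) + 1)) (D.expField ρ 0) (D.expField_zero ρ) k
  refine (congrArg (fun F => (F (D.expField ρ 0)).1 k) h1).trans (Eq.trans h2 ?_)
  simp [currentMode]

end ExponentialFields

/-! ### The pairing of the eigenspaces of `σ` -/

section EigenspacePairing

variable {L : Type*} [AddCommGroup L] (D : LatticeDatum L)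

theorem formC_symm (x y : Cartan L) : D.formC x y = D.formC y x :=
  (LinearMap.BilinForm.IsSymm.baseChange ℂ ⟨D.form_symm⟩).eq x y

theorem formC_σC (x y : Cartan L) : D.formC (D.σC x) (D.σC y) = D.formC x y := by
  induction x using TensorProduct.induction_on with
  | zero => simp
  | add a b ha hb => simp only [map_add, LinearMap.add_apply, ha, hb]
  | tmul a α =>
    induction y using TensorProduct.induction_on with
    | zero => simp
    | add c d hc hd => simp only [map_add, hc, hd]
    | tmul b β => simp [formC, σC, D.form_σ]

theorem formC_σC_pow (r : ℕ) (x y : Cartan L) :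
    D.formC ((D.σC ^ r) x) ((D.σC ^ r) y) = D.formC x y := by
  induction r with
  | zero => simp
  | succ r ih => rw [pow_succ', Module.End.mul_apply, Module.End.mul_apply, formC_σC, ih]

theorem σC_pow_apply_of_mem_eig {n : ℤ} {y : Cartan L} (hy : y ∈ D.eig n) (r : ℕ) :
    (D.σC ^ r) y = D.ζ ^ (n * r) • y := by
  induction r with
  | zero => simp
  | succ r ih =>
    rw [pow_succ', Module.End.mul_apply, ih, map_smul, Module.End.mem_eigenspace_iff.1 hy,
      smul_smul, ← zpow_add₀ D.ζ_ne_zero]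
    congr 2
    push_cast
    ring

theorem p_ne_zero : (D.p : ℂ) ≠ 0 := Nat.cast_ne_zero.2 D.p_pos.ne'

theorem proj_apply_coe (n : ℤ) (h : Cartan L) : (D.proj n h : Cartan L) =
    (D.p : ℂ)⁻¹ • ∑ r ∈ Finset.range D.p, (D.ζ ^ (-n * r)) • (D.σC ^ r) h := by
  simp [proj]

theorem proj_of_mem_eig {n : ℤ} {y : Cartan L} (hy : y ∈ D.eig n) : D.proj n y = ⟨y, hy⟩ := by
  refine Subtype.ext ?_
  have h1 : ∀ r ∈ Finset.range D.p, (D.ζ ^ (-n * (r : ℤ))) • (D.σC ^ r) y = y := fun r _ => by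
    rw [σC_pow_apply_of_mem_eig D hy, smul_smul, ← zpow_add₀ D.ζ_ne_zero]
    simp
  rw [proj_apply_coe, Finset.sum_congr rfl h1, Finset.sum_const, Finset.card_range,
    ← Nat.cast_smul_eq_nsmul ℂ, smul_smul, inv_mul_cancel₀ D.p_ne_zero, one_smul]

/-- The eigenspaces of `σ` with eigenvalues `ζⁿ` and `ζ⁻ⁿ` are paired by the form, and
orthogonal to the other ones. -/
theorem formC_proj_of_mem_eig {n : ℤ} {y : Cartan L} (hy : y ∈ D.eig (-n)) (h : Cartan L) :
    D.formC (D.proj n h) y = D.formC h y := by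
  have h1 : ∀ r ∈ Finset.range D.p,
      D.formC ((D.ζ ^ (-n * (r : ℤ))) • (D.σC ^ r) h) y = D.formC h y := fun r _ => by
    rw [← D.formC_σC_pow r h y, σC_pow_apply_of_mem_eig D hy, map_smul, map_smul,
      LinearMap.smul_apply]
  rw [proj_apply_coe, map_smul, LinearMap.smul_apply, map_sum, LinearMap.sum_apply,
    Finset.sum_congr rfl h1, Finset.sum_const, Finset.card_range, nsmul_eq_mul, smul_eq_mul,
    inv_mul_cancel_left₀ D.p_ne_zero]

variable [Module.Free ℤ L] [Module.Finite ℤ L]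

theorem formC_nondegenerate : D.formC.Nondegenerate := by
  have h1 : D.form.Nondegenerate := .ofSeparatingLeft fun x hx => by
    by_contra h0
    exact (D.form_pos x h0).ne' (hx x)
  let b := Module.finBasis ℤ L
  have h2 : LinearMap.BilinForm.toMatrix (b.baseChange ℂ) D.formC =
      (LinearMap.BilinForm.toMatrix b D.form).map (Int.castRingHom ℂ) := by
    ext i j
    simp [LinearMap.BilinForm.toMatrix_apply, formC]
  refine (LinearMap.BilinForm.nondegenerate_iff_det_ne_zero (b.baseChange ℂ)).2 ?_
  rw [h2, ← RingHom.mapMatrix_apply, ← RingHom.map_det]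
  exact Int.cast_ne_zero.2 ((LinearMap.BilinForm.nondegenerate_iff_det_ne_zero b).1 h1)

/-- Every linear functional on the creation operators of a given depth is the bracket with an
annihilation operator. -/
theorem twistedBracket_surjective (m : ℕ) (φ : D.eig (-(m + 1 : ℤ)) →ₗ[ℂ] ℂ) :
    ∃ h, D.twistedBracket h m = φ := by
  obtain ⟨ψ, hψ⟩ := LinearMap.exists_extend φ
  have hm : ((m : ℂ) + 1) / D.p ≠ 0 := div_ne_zero (Nat.cast_add_one_ne_zero m) D.p_ne_zero
  refine ⟨(((m : ℂ) + 1) / D.p)⁻¹ • (D.formC.toDual D.formC_nondegenerate).symm ψ, ?_⟩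
  ext y
  rw [twistedBracket_smul, LinearMap.smul_apply, twistedBracket, LinearMap.smul_apply,
    inv_smul_smul₀ hm, ← hψ]
  refine (D.formC_proj_of_mem_eig y.2 _).trans ?_
  exact LinearMap.BilinForm.apply_toDual_symm_apply _ _

end EigenspacePairing

/-! ### Heisenberg submodules -/

section HeisenbergSubmodules

variable {L : Type*} [AddCommGroup L] (D : LatticeDatum L)
variable {T : Type*} [AddCommGroup T] [Module ℂ T] (ρ : Representation ℂ (D.hat D.N) T)

/-- A Heisenberg submodule which contains the vacuum space `1 ⊗ U_T` is all of `V_L^T`. -/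
theorem eq_top_of_vacuum_le (S : Submodule ℂ (D.VLT ρ))
    (hS : ∀ h j, ∀ w ∈ S, D.mode ρ h j w ∈ S) (hvac : ∀ u : D.UT ρ, (1 : D.TwistedFock) ⊗ₜ u ∈ S) :
    S = ⊤ := by
  have hadd : ∀ a b : D.TwistedFock,
      LinearMap.mulLeft ℂ (a + b) = LinearMap.mulLeft ℂ a + LinearMap.mulLeft ℂ b :=
    fun a b => LinearMap.ext fun x => add_mul a b x
  have key : ∀ s : D.TwistedFock, ∀ w ∈ S,
      (TensorProduct.map (LinearMap.mulLeft ℂ s) LinearMap.id : Module.End ℂ (D.VLT ρ)) w ∈ S := by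
    intro s
    induction s using SymmetricAlgebra.induction with
    | algebraMap r =>
      intro w hw
      have h1 : LinearMap.mulLeft ℂ (algebraMap ℂ D.TwistedFock r) = r • LinearMap.id := by
        ext x; simp [Algebra.smul_def]
      rw [h1, TensorProduct.map_smul_left, TensorProduct.map_id]
      exact S.smul_mem r hw
    | ι x =>
      induction x using DirectSum.induction_on with
      | zero => intro w _; simp
      | of m y =>
        intro w hw
        have h1 := hS y (Int.negSucc m) w hw
        simp only [mode, D.proj_of_mem_eig y.2] at h1
        exact h1
      | add x y hx hy =>
        intro w hw
        rw [map_add, hadd, TensorProduct.map_add_left]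
        exact S.add_mem (hx w hw) (hy w hw)
    | mul a b ha hb =>
      intro w hw
      rw [LinearMap.mulLeft_mul, ← LinearMap.id_comp (LinearMap.id : D.UT ρ →ₗ[ℂ] D.UT ρ),
        TensorProduct.map_comp]
      exact ha _ (hb w hw)
    | add a b ha hb =>
      intro w hw
      rw [hadd, TensorProduct.map_add_left]
      exact S.add_mem (ha w hw) (hb w hw)
  refine (Submodule.eq_top_iff').2 fun w => ?_
  induction w using TensorProduct.induction_on with
  | zero => exact S.zero_mem
  | tmul s u => simpa using key s _ (hvac u)
  | add a b ha hb => exact S.add_mem ha hb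

variable [Module.Free ℤ L] [Module.Finite ℤ L]

/-- The joint kernel of the annihilation operators on the Fock space is spanned by the vacuum. -/
theorem exists_smul_one_of_annihilator_eq_zero (s : D.TwistedFock)
    (hs : ∀ h m, annihilator m (D.twistedBracket h m) s = 0) : ∃ c : ℂ, s = c • 1 := by
  classical
  let b : Module.Basis (Σ m : ℕ, Module.Basis.ofVectorSpaceIndex ℂ (D.eig (-(m + 1 : ℤ)))) ℂ
      (DirectSum ℕ fun m : ℕ => D.eig (-(m + 1 : ℤ))) :=
    DFinsupp.basis fun m => Module.Basis.ofVectorSpace ℂ (D.eig (-(m + 1 : ℤ)))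
  refine exists_smul_one_of_contract_eq_zero b s ?_
  rintro ⟨m, i⟩
  obtain ⟨h, hh⟩ := D.twistedBracket_surjective m
    ((Module.Basis.ofVectorSpace ℂ (D.eig (-(m + 1 : ℤ)))).coord i)
  have h1 : b.coord ⟨m, i⟩ =
      (D.twistedBracket h m) ∘ₗ DirectSum.component ℂ ℕ (fun m : ℕ => D.eig (-(m + 1 : ℤ))) m := by
    rw [hh]
    ext x
    rfl
  rw [h1]
  exact hs h m

/-- A nonzero Heisenberg submodule contains a nonzero vacuum vector: one of its nonzero elements
of least depth. -/
theorem exists_vacuum_mem (S : Submodule ℂ (D.VLT ρ))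
    (hS : ∀ h j, ∀ w ∈ S, D.mode ρ h j w ∈ S) (h0 : S ≠ ⊥) :
    ∃ u : D.UT ρ, u ≠ 0 ∧ (1 : D.TwistedFock) ⊗ₜ u ∈ S := by
  obtain ⟨w, hw, hw0, hkill⟩ := exists_mem_of_lowers (D.isFil_VLT ρ)
    (fun i : Cartan L × ℕ => D.mode ρ i.1 (i.2 + 1 : ℕ)) (fun i => (i.2 + 1 : ℕ))
    (fun i => Int.natCast_pos.2 i.2.succ_pos) (fun i => D.lowers_mode ρ i.1 (i.2 + 1)) S
    (fun i w hw => hS _ _ w hw) h0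
  have h1 := exists_one_tmul_of_derivation_eq_zero (A := D.TwistedFock) (U := D.UT ρ)
    (fun i : Cartan L × ℕ => annihilator i.2 (D.twistedBracket i.1 i.2))
    (fun s hs => D.exists_smul_one_of_annihilator_eq_zero s fun h m => hs (h, m)) w hkill
  obtain ⟨u, hu⟩ := h1
  refine ⟨u, fun hu0 => hw0 ?_, hu ▸ hw⟩
  rw [hu, hu0, TensorProduct.tmul_zero]

end HeisenbergSubmodules

/-! ### Recovering `e_α` from `W(e^α, z)` -/

section GroupElements

variable {L : Type*} [AddCommGroup L] (D : LatticeDatum L)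
variable {T : Type*} [AddCommGroup T] [Module ℂ T] (ρ : Representation ℂ (D.hat D.N) T)

theorem vertexConst_ne_zero (α : L) : D.vertexConst α ≠ 0 := by
  refine mul_ne_zero (zpow_ne_zero _ D.p_ne_zero) (Finset.prod_ne_zero_iff.2 fun r hr => ?_)
  refine zpow_ne_zero _ (sub_ne_zero.2 fun h => ?_)
  rw [Finset.mem_Icc] at hr
  -- `ζʳ = ξ ^ (2r)`, and `0 < 2r < 2p`.
  refine D.ξ_primitive.pow_ne_one_of_pos_of_lt (l := 2 * r) (by omega) ?_ ?_
  · change 2 * r < 2 * D.p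
    have := D.p_pos
    omega
  · rw [pow_mul]
    exact h.symm

theorem Eplus_one_tmul (α : L) (j : ℕ) (u : D.UT ρ) :
    D.Eplus ρ α j ((1 : D.TwistedFock) ⊗ₜ u) = if j = 0 then 1 ⊗ₜ u else 0 := by
  refine expCoeff_apply_of_coeff_apply_eq_zero _ _ (fun i => ?_) j
  rw [PowerSeries.coeff_mk]
  rcases i with _ | i
  -- The series has no constant term, as `p / 0 = 0`.
  · simp
  · have h1 : D.mode ρ (1 ⊗ₜ α) ((i + 1 : ℕ) : ℤ) ((1 : D.TwistedFock) ⊗ₜ u) =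
        annihilator i (D.twistedBracket (1 ⊗ₜ α) i) 1 ⊗ₜ u := rfl
    rw [LinearMap.smul_apply, h1, Derivation.map_one_eq_zero, TensorProduct.zero_tmul, smul_zero]

theorem finsuppSum_zPow (α : L) (u : D.UT ρ) :
    ((D.zPow ρ α u).sum fun _ v => v) = u := by
  have : (Finsupp.lsum ℂ fun _ : ℤ => (LinearMap.id : D.UT ρ →ₗ[ℂ] D.UT ρ)) ∘ₗ D.zPow ρ α =
      LinearMap.id := by
    refine Representation.IndV.hom_ext _ _ fun g => LinearMap.ext fun t => ?_
    have h1 := D.zPow_mk ρ α g t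
    change (Finsupp.lsum ℂ fun _ : ℤ => (LinearMap.id : D.UT ρ →ₗ[ℂ] D.UT ρ))
      (D.zPow ρ α (UT.mk D ρ g t)) = UT.mk D ρ g t
    rw [h1]
    simp
  exact congrArg (fun f => f u) this

theorem Eminus_mem (S : Submodule ℂ (D.VLT ρ)) (hS : ∀ h j, ∀ w ∈ S, D.mode ρ h j w ∈ S)
    (α : L) (j : ℕ) (w : D.VLT ρ) (hw : w ∈ S) : D.Eminus ρ α j w ∈ S := by
  refine expCoeff_apply_mem _ S (fun i x hx => ?_) j w hw
  rw [PowerSeries.coeff_mk]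
  exact S.smul_mem _ (hS _ _ x hx)

/-- If a Heisenberg submodule is stable under `W(e^α, z)`, its space of vacuum vectors is stable
under `e_α`. On a vacuum vector `W(e^α, z)` acts as `E⁻_σ(-α, z) e_α` up to powers of `z` and a
nonzero constant, and the constant term of `E⁻_σ(-α, z)` is `1`; so the components of `e_α u` for
the powers of `z` are recovered one after the other, starting with the lowest power. -/
theorem groupAct_mem_of_expField_mem (S : Submodule ℂ (D.VLT ρ))
    (hS : ∀ h j, ∀ w ∈ S, D.mode ρ h j w ∈ S) (α : L)
    (hα : ∀ k, ∀ w ∈ S, (D.expField ρ α).1 k w ∈ S) (u : D.UT ρ)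
    (hu : (1 : D.TwistedFock) ⊗ₜ u ∈ S) : (1 : D.TwistedFock) ⊗ₜ D.groupAct ρ ⟨0, α⟩ u ∈ S := by
  set c := D.zPow ρ α u with hc
  set d := D.expShift α
  let y : ℤ → D.VLT ρ := fun l => 1 ⊗ₜ D.groupAct ρ ⟨0, α⟩ (c l)
  have hF : ∀ k, ∑ l ∈ c.support, (if 0 ≤ k - l - d then
      D.Eminus ρ α (k - l - d).toNat (y l) else 0) ∈ S := by
    intro k
    have h1 := hα k _ hu
    rw [D.expField_tmul ρ α 1 (D.Eplus_one_tmul ρ α)] at h1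
    exact (S.smul_mem_iff (D.vertexConst_ne_zero α)).1 h1
  have hy : ∀ n : ℕ, ∀ l ∈ c.support, (∀ l' ∈ c.support, l' ≤ l → (l - l').toNat < n) →
      y l ∈ S := by
    intro n
    induction n with
    | zero => intro l hl h; exact absurd (h l hl le_rfl) (by simp)
    | succ n ih =>
      intro l hl hn
      have h1 := hF (l + d)
      rw [← Finset.add_sum_erase _ _ hl] at h1
      have h2 : (if 0 ≤ l + d - l - d then D.Eminus ρ α (l + d - l - d).toNat (y l) else 0) =
          y l := by
        have h3 : l + d - l - d = 0 := by ring
        rw [h3, if_pos le_rfl, Int.toNat_zero, Eminus, expCoeff_zero_index]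
        rfl
      rw [h2] at h1
      refine (S.add_mem_iff_left (S.sum_mem fun l' hl' => ?_)).1 h1
      obtain ⟨hne, hl'⟩ := Finset.mem_erase.1 hl'
      split_ifs with hle
      · refine D.Eminus_mem ρ S hS α _ _ (ih l' hl' fun l'' hl'' hle' => ?_)
        have := hn l'' hl'' (by omega)
        omega
      · exact S.zero_mem
  have hyS : ∀ l ∈ c.support, y l ∈ S := by
    intro l hl
    obtain ⟨B, hB⟩ := c.support.bddBelow
    refine hy ((l - B).toNat + 1) l hl fun l' hl' hle => ?_
    have := hB hl'
    omega
  have h4 : (1 : D.TwistedFock) ⊗ₜ D.groupAct ρ ⟨0, α⟩ u = ∑ l ∈ c.support, y l := by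
    conv_lhs => rw [← D.finsuppSum_zPow ρ α u, ← hc, Finsupp.sum, map_sum, TensorProduct.tmul_sum]
  rw [h4]
  exact S.sum_mem hyS

end GroupElements

/-! ### The induced module `U_T` -/

section InducedModule

variable {L : Type*} [AddCommGroup L] (D : LatticeDatum L)
variable {T : Type*} [AddCommGroup T] [Module ℂ T] (ρ : Representation ℂ (D.hat D.N) T)

theorem groupAct_mk (g g' : D.Ext) (t : T) :
    D.groupAct ρ g (UT.mk D ρ g' t) = UT.mk D ρ (g' * g⁻¹) t :=
  Representation.ind_mk _ _ g g' t

/-- The vectors over a coset of `N` are all of the form `g⁻¹ · t` for a fixed `g` over that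
coset. -/
theorem mk_eq_mk_of_sub_mem (g g' : D.Ext) (h : g.bar - g'.bar ∈ D.N) (t : T) :
    ∃ n : D.hat D.N, UT.mk D ρ g t = UT.mk D ρ g' (ρ n t) := by
  have hn : g * g'⁻¹ ∈ D.hat D.N := by
    change g.bar + -g'.bar ∈ D.N
    rwa [← sub_eq_add_neg]
  refine ⟨⟨_, hn⟩⁻¹, ?_⟩
  rw [← UT.mk_mul D ρ ⟨_, hn⟩ g', ← Module.End.mul_apply, ← map_mul, mul_inv_cancel, map_one]
  simp

/-- `U_T` is the sum of its subspaces over the cosets of `N`. -/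
theorem exists_eq_sum_mk (u : D.UT ρ) : ∃ f : (L ⧸ D.N) →₀ T,
    u = f.sum fun q t => UT.mk D ρ ⟨0, q.out⟩ t := by
  let Φ : ((L ⧸ D.N) →₀ T) →ₗ[ℂ] D.UT ρ := Finsupp.lsum ℂ fun q => UT.mk D ρ ⟨0, q.out⟩
  have hΦ : (LinearMap.range Φ).mkQ = 0 := by
    refine Representation.IndV.hom_ext _ _ fun g => LinearMap.ext fun t => ?_
    refine (Submodule.Quotient.mk_eq_zero _).2 ?_
    obtain ⟨n, hn⟩ := D.mk_eq_mk_of_sub_mem ρ g ⟨0, (Submodule.Quotient.mk (p := D.N) g.bar).out⟩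
      ((Submodule.Quotient.eq D.N).1 (Quotient.out_eq _).symm) t
    refine ⟨Finsupp.single (Submodule.Quotient.mk g.bar) (ρ n t), Eq.trans ?_ hn.symm⟩
    exact Finsupp.sum_single_index (map_zero _)
  have hu : u ∈ LinearMap.range Φ := by
    rw [← Submodule.Quotient.mk_eq_zero]
    exact congrArg (fun f => f u) hΦ
  obtain ⟨f, rfl⟩ := hu
  exact ⟨f, rfl⟩

/-- The weights of the zero modes separate the cosets of `N`. -/
theorem weight_injective : Function.Injective fun (q : L ⧸ D.N) (h : Cartan L) =>
    D.formC (D.proj 0 h) (1 ⊗ₜ (-q.out)) := by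
  intro q q' hqq
  rw [← Quotient.out_eq q, ← Quotient.out_eq q']
  refine (Submodule.Quotient.eq D.N).2 fun h hh => ?_
  have h1 := congrFun hqq h
  simp only [D.proj_of_mem_eig hh, TensorProduct.tmul_neg, map_neg, neg_inj] at h1
  rw [formC_symm, TensorProduct.tmul_sub, map_sub, sub_eq_zero]
  exact h1

theorem rho_central (hκ : ∀ t, ρ ⟨⟨1, 0⟩, D.N.zero_mem⟩ t = D.ξ • t) (a : ℕ) (t : T) :
    ρ ⟨⟨a, 0⟩, D.N.zero_mem⟩ t = D.ξ ^ a • t := by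
  induction a with
  | zero =>
    have h1 : (⟨⟨(0 : ℕ), 0⟩, D.N.zero_mem⟩ : D.hat D.N) = 1 :=
      Subtype.ext (by simp [Ext.one_def])
    rw [h1, map_one, pow_zero, one_smul]
    rfl
  | succ a ih =>
    have h1 : (⟨⟨(a + 1 : ℕ), 0⟩, D.N.zero_mem⟩ : D.hat D.N) =
        ⟨⟨1, 0⟩, D.N.zero_mem⟩ * ⟨⟨a, 0⟩, D.N.zero_mem⟩ :=
      Subtype.ext (by
        change (⟨_, _⟩ : D.Ext) = ⟨_, _⟩ * ⟨_, _⟩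
        rw [Ext.mul_def]
        simp [D.εσ_zero_left, add_comm])
    rw [h1, map_mul, Module.End.mul_apply, ih, map_smul, hκ, smul_smul, pow_succ]

/-- Irreducibility of `U_T` under the elements `e_α` and the zero modes: the zero modes isolate
the component over a coset of `N`, some `e_α` moves it to `T`, and `T` is irreducible. -/
theorem eq_top_of_groupAct_mem (hρ : D.IsInducing ρ) (S : Submodule ℂ (D.UT ρ))
    (hzero : ∀ h, ∀ u ∈ S, D.zeroMode ρ h u ∈ S)
    (hgrp : ∀ α, ∀ u ∈ S, D.groupAct ρ ⟨0, α⟩ u ∈ S) (h0 : S ≠ ⊥) : S = ⊤ := by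
  obtain ⟨u, hu, hu0⟩ := S.exists_mem_ne_zero_of_ne_bot h0
  obtain ⟨f, rfl⟩ := D.exists_eq_sum_mk ρ u
  have hcomp := mem_of_sum_mem_of_weights (D.zeroMode ρ) S hzero _ D.weight_injective f.support
    (fun q => UT.mk D ρ ⟨0, q.out⟩ (f q)) (fun q _ h => D.zeroMode_mk ρ h _ _) hu
  obtain ⟨q, hq⟩ : f.support.Nonempty := by
    by_contra hne
    exact hu0 (by rw [Finsupp.sum, Finset.not_nonempty_iff_eq_empty.1 hne, Finset.sum_empty])
  -- The vectors of `T` in `S` form a subrepresentation.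
  let S' : Subrepresentation ρ :=
    { toSubmodule := S.comap (UT.mk D ρ 1)
      apply_mem_toSubmodule := by
        have : NeZero (2 * orderOf D.σ) := ⟨mul_ne_zero two_ne_zero D.p_pos.ne'⟩
        rintro ⟨⟨a, α⟩, hα⟩ t ht
        obtain ⟨a, rfl⟩ := ZMod.natCast_zmod_surjective a
        have h1 : (⟨⟨a, α⟩, hα⟩ : D.hat D.N) = ⟨⟨a, 0⟩, D.N.zero_mem⟩ * ⟨⟨0, α⟩, hα⟩ :=
          Subtype.ext (by
            change (⟨_, _⟩ : D.Ext) = ⟨_, _⟩ * ⟨_, _⟩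
            rw [Ext.mul_def]
            simp [D.εσ_zero_left])
        rw [h1, map_mul, Module.End.mul_apply, D.rho_central ρ hρ.kappa]
        refine Submodule.smul_mem _ _ ?_
        have h2 := hgrp α _ ht
        rw [groupAct_mk, one_mul] at h2
        have h3 := UT.mk_mul D ρ ⟨⟨0, α⟩, hα⟩ (⟨0, α⟩⁻¹) t
        rw [mul_inv_cancel] at h3
        rw [← h3] at h2
        exact h2 }
  have hT : S' = ⊤ := by
    have := hρ.irreducible
    refine (eq_bot_or_eq_top S').resolve_left fun hbot => ?_
    have h1 := hgrp q.out _ (hcomp q hq)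
    rw [groupAct_mk, mul_inv_cancel] at h1
    have h2 : f q ∈ S' := h1
    rw [hbot] at h2
    exact Finsupp.mem_support_iff.1 hq h2
  have hmk : ∀ t, UT.mk D ρ 1 t ∈ S := fun t => by
    have : t ∈ S' := hT ▸ trivial
    exact this
  refine Submodule.eq_top_iff'.2 fun v => ?_
  obtain ⟨f, rfl⟩ := D.exists_eq_sum_mk ρ v
  refine S.sum_mem fun q _ => ?_
  have hinv : (⟨0, q.out⟩ : D.Ext).bar - (⟨0, -q.out⟩⁻¹ : D.Ext).bar ∈ D.N := by
    simp [Ext.inv_def]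
  obtain ⟨n, hn⟩ := D.mk_eq_mk_of_sub_mem ρ _ _ hinv (f q)
  have h1 := hgrp (-q.out) _ (hmk (ρ n (f q)))
  rw [groupAct_mk, one_mul, ← hn] at h1
  exact h1

/-- The projection of `U_T` onto its subspace `T` over the trivial coset of `N`. -/
def toT : D.UT ρ →ₗ[ℂ] T := by
  classical
  exact UT.lift D ρ (fun g => if hg : g ∈ D.hat D.N then ρ ⟨g, hg⟩⁻¹ else 0) fun n g t => by
    by_cases hg : g ∈ D.hat D.N
    · have hng : (n : D.Ext) * g ∈ D.hat D.N := mul_mem n.2 hg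
      have h1 : (⟨(n : D.Ext) * g, hng⟩ : D.hat D.N) = n * ⟨g, hg⟩ := rfl
      rw [dif_pos hng, dif_pos hg, h1, mul_inv_rev, map_mul, Module.End.mul_apply,
        ← Module.End.mul_apply (ρ n⁻¹), ← map_mul, inv_mul_cancel, map_one]
      rfl
    · have hng : (n : D.Ext) * g ∉ D.hat D.N := fun h =>
        hg ((Subgroup.mul_mem_cancel_left _ n.2).1 h)
      rw [dif_neg hng, dif_neg hg]
      rfl

theorem toT_mk_one (t : T) : D.toT ρ (UT.mk D ρ 1 t) = t := by
  rw [toT, UT.lift_mk, dif_pos (one_mem _)]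
  have h1 : (⟨1, one_mem _⟩ : D.hat D.N)⁻¹ = 1 := inv_one
  rw [h1, map_one]
  rfl

theorem nontrivial_VLT (hρ : D.IsInducing ρ) : Nontrivial (D.VLT ρ) := by
  have hT : ∃ t : T, t ≠ 0 := by
    by_contra! hall
    have := hρ.irreducible
    refine (bot_ne_top : (⊥ : Subrepresentation ρ) ≠ ⊤) ?_
    ext t
    rw [hall t]
    exact ⟨fun _ => trivial, fun _ => Submodule.zero_mem ⊥⟩
  obtain ⟨t, ht⟩ := hT
  let ε : D.TwistedFock →ₐ[ℂ] ℂ := SymmetricAlgebra.lift 0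
  refine ⟨⟨1 ⊗ₜ UT.mk D ρ 1 t, 0, fun h => ht ?_⟩⟩
  have h1 := congrArg (TensorProduct.lid ℂ T ∘ TensorProduct.map ε.toLinearMap (D.toT ρ)) h
  simpa only [Function.comp_apply, TensorProduct.map_tmul, AlgHom.toLinearMap_apply, map_one,
    toT_mk_one, TensorProduct.lid_tmul, one_smul, map_zero] using h1

end InducedModule

/-! ### Twisted submodules -/

section TwistedSubmodules

variable {L : Type*} [AddCommGroup L] (D : LatticeDatum L) [Module.Free ℤ L] [Module.Finite ℤ L]
variable {T : Type*} [AddCommGroup T] [Module ℂ T] (ρ : Representation ℂ (D.hat D.N) T)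

theorem mode_mem_of_isTwistedSubmodule (S : Submodule ℂ (D.VLT ρ))
    (hS : D.IsTwistedSubmodule ρ S) (h : Cartan L) (j : ℤ) (w : D.VLT ρ) (hw : w ∈ S) :
    D.mode ρ h j w ∈ S := by
  have h1 := hS (creator (H := fun _ : ℕ => Cartan L) 0 h ⊗ₜ Finsupp.single 0 1) (-j - D.p) w hw
  have hj : -(-j - (D.p : ℤ)) - D.p = j := by ring
  rwa [Yσ_creator, hj] at h1

theorem expField_mem_of_isTwistedSubmodule (S : Submodule ℂ (D.VLT ρ))
    (hS : D.IsTwistedSubmodule ρ S) (α : L) (k : ℤ) (w : D.VLT ρ) (hw : w ∈ S) :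
    (D.expField ρ α).1 k w ∈ S := by
  have h1 := hS (1 ⊗ₜ Finsupp.single α 1) k w hw
  rwa [Yσ_one_tmul_single] at h1

end TwistedSubmodules

end LatticeDatum
end TwistedLattice

end

theorem lemma2p2 {L : Type*} [AddCommGroup L] [Module.Free ℤ L] [Module.Finite ℤ L]
    (D : LatticeDatum L) {T : Type*} [AddCommGroup T] [Module ℂ T] [FiniteDimensional ℂ T]
    (ρ : Representation ℂ (D.hat D.N) T) (hρ : D.IsInducing ρ) :
    D.IsIrreducibleTwisted ρ := by
  refine ⟨D.nontrivial_VLT ρ hρ, fun S hS => or_iff_not_imp_left.2 fun h0 => ?_⟩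
  have hmode := D.mode_mem_of_isTwistedSubmodule ρ S hS
  have hexp := D.expField_mem_of_isTwistedSubmodule ρ S hS
  obtain ⟨u, hu0, hu⟩ := D.exists_vacuum_mem ρ S hmode h0
  have hvac : S.comap (TensorProduct.mk ℂ D.TwistedFock (D.UT ρ) 1) = ⊤ := by
    refine D.eq_top_of_groupAct_mem ρ hρ _ (fun h v hv => hmode h 0 _ hv)
      (fun α v hv => D.groupAct_mem_of_expField_mem ρ S hmode α (hexp α) v hv) fun hbot => hu0 ?_
    have h1 : u ∈ S.comap (TensorProduct.mk ℂ D.TwistedFock (D.UT ρ) 1) := hu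
    rwa [hbot] at h1
  refine D.eq_top_of_vacuum_le ρ S hmode fun v => ?_
  have h1 : v ∈ S.comap (TensorProduct.mk ℂ D.TwistedFock (D.UT ρ) 1) := hvac ▸ trivial
  exact h1
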